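/- Let $n\ge 0$, let $V$ be a complex vector space of dimension $2n$ with a symplectic form $\sigma$ (a nondegenerate alternating bilinear form), and let $\mathbb{LG}_n$ be the Lagrangian Grassmannian, i.e. the complex manifold of all maximal isotropic ($n$-dimensional isotropic) subspaces $L\subset V$. Let $Q_n$ be the tautological quotient bundle on $\mathbb{LG}_n$, with fibre $V/L$ at $L$, let $\mathcal O(1)=\det Q_n=\bigwedge^n Q_n$, and let $Q_n(1)=Q_n\otimes\mathcal O(1)$. Fix a hermitian inner product on $V$ (for instance one for which a compact real form of $Sp(V,\sigma)$ is unitary, so that the metrics below are homogeneous), and endow $Q_n$ with the metric induced from the constant metric on the trivial bundle with fibre $V$, $\det Q_n$ with the metric $\langle v_1\wedge\dots\wedge v_n,w_1\wedge\dots\wedge w_n\rangle=\det(\langle v_i,w_j\rangle)$, and $Q_n(1)$ with the tensor product metric. Then this is a smooth hermitian metric on the holomorphic vector bundle $Q_n(1)$, and it is Nakano positive: at every point of $\mathbb{LG}_n$, for all local holomorphic coordinates $(z_j)$ and all local holomorphic frames $(e_\lambda)$ of $Q_n(1)$ around it, if $\Theta=\sum_{j,k}\Theta_{jk}\,dz_j\wedge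 d\bar z_k$ is the curvature of the Chern connection (with $\Theta_{jk}$ endomorphisms of $Q_n(1)$), then $$u=\sum_{j,\lambda}u_{j\lambda}\,\frac{\partial}{\partial z_j}\otimes e_\lambda\ \longmapsto\ \sum_{j,k,\lambda,\mu}\langle\Theta_{jk}e_\lambda,e_\mu\rangle\,u_{j\lambda}\overline{u_{k\mu}}$$ is a positive definite hermitian form on $T\,\mathbb{LG}_n\otimes Q_n(1)$. -/

import Mathlib

open Module Bundle
open scoped Manifold ContDiff TensorProduct Matrix

/-- A symplectic form on a complex vector space of dimension `2n`. -/
structure SymplecticForm (n : ℕ) (V : Type*) [AddCommGroup V] [Module ℂ V] where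
  form : LinearMap.BilinForm ℂ V
  isAlt : form.IsAlt
  nondegenerate : form.Nondegenerate
  finrank_eq : finrank ℂ V = 2 * n

/-- The Lagrangian Grassmannian: the set of maximal isotropic subspaces, i.e. of the isotropic
subspaces of dimension `n`. -/
structure LagrangianGrassmannian {n : ℕ} {V : Type*} [AddCommGroup V] [Module ℂ V]
    (σ : SymplecticForm n V) where
  carrier : Submodule ℂ V
  isotropic : ∀ v ∈ carrier, ∀ w ∈ carrier, σ.form v w = 0
  finrank_eq : finrank ℂ carrier = n

/-- The space of complex symmetric `n × n` matrices. -/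
def SymMat (n : ℕ) : Submodule ℂ (Fin n → Fin n → ℂ) where
  carrier := {S | ∀ i j, S i j = S j i}
  add_mem' := by
    intro S T hS hT i j
    simp [hS i j, hT i j]
  zero_mem' := by intro i j; simp
  smul_mem' := by
    intro c S hS i j
    simp [hS i j]

namespace SymMat

variable {n : ℕ}

/-- The endomorphism `x ↦ S x` of `ℂⁿ` given by a symmetric matrix. -/
noncomputable def op : SymMat n →ₗ[ℂ] ((Fin n → ℂ) →L[ℂ] (Fin n → ℂ)) :=
  (LinearMap.toContinuousLinearMap (𝕜 := ℂ) (E := Fin n → ℂ) (F' := Fin n → ℂ)).toLinearMap ∘ₗ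
    (Matrix.toLin' (R := ℂ) (m := Fin n) (n := Fin n)).toLinearMap ∘ₗ
    (Matrix.ofLinearEquiv ℂ).toLinearMap ∘ₗ (SymMat n).subtype

theorem op_apply (S : SymMat n) (x : Fin n → ℂ) : op S x = Matrix.of S.1 *ᵥ x := rfl

theorem op_single (S : SymMat n) (i j : Fin n) : op S (Pi.single j 1) i = S.1 i j := by
  simp [op_apply]

theorem op_injective : Function.Injective (op (n := n)) := by
  intro S T h
  ext i j
  rw [← op_single, ← op_single, h]

theorem op_symm (S : SymMat n) (x y : Fin n → ℂ) : x ⬝ᵥ op S y = op S x ⬝ᵥ y := by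
  have : (Matrix.of S.1).transpose = Matrix.of S.1 := by
    ext i j
    exact S.2 j i
  rw [op_apply, op_apply, Matrix.dotProduct_mulVec, ← Matrix.mulVec_transpose, this]

theorem exists_op {T : (Fin n → ℂ) →L[ℂ] (Fin n → ℂ)} (h : ∀ x y, x ⬝ᵥ T y = T x ⬝ᵥ y) :
    ∃ S : SymMat n, op S = T := by
  refine ⟨⟨fun i j => T (Pi.single j 1) i, fun i j => ?_⟩, ?_⟩
  · simpa using h (Pi.single i 1) (Pi.single j 1)
  · ext x i
    rw [op_apply]
    have := LinearMap.toMatrix'_mulVec (T : (Fin n → ℂ) →ₗ[ℂ] (Fin n → ℂ)) x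
    exact congrFun this i

theorem contDiff_op : ContDiff ℂ ω (op (n := n)) :=
  (⟨op, LinearMap.continuous_of_finiteDimensional (𝕜 := ℂ) op⟩ : SymMat n →L[ℂ] _).contDiff

theorem contDiffOn_of_op {f : SymMat n → SymMat n} {s : Set (SymMat n)}
    (h : ContDiffOn ℂ ω (fun S => op (f S)) s) : ContDiffOn ℂ ω f s := by
  obtain ⟨p, hp⟩ := LinearMap.exists_leftInverse_of_injective (K := ℂ) (SymMat n).subtype
    (Submodule.ker_subtype _)
  let p' : (Fin n → Fin n → ℂ) →L[ℂ] SymMat n := LinearMap.toContinuousLinearMap p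
  have hf : ∀ S, f S = p' (fun i j => op (f S) (Pi.single j 1) i) := by
    intro S
    have : (fun i j => op (f S) (Pi.single j 1) i) = (f S).1 := by
      ext i j
      rw [op_single]
    rw [this]
    exact (LinearMap.congr_fun hp (f S)).symm
  have h1 : ContDiffOn ℂ ω (fun S => (fun i j => op (f S) (Pi.single j 1) i)) s :=
    contDiffOn_pi.2 fun i => contDiffOn_pi.2 fun j =>
      contDiffOn_pi.1 (h.clm_apply contDiffOn_const) i
  exact (p'.contDiff.comp_contDiffOn h1).congr fun S _ => hf S

end SymMat

/-- Linear symplectic isomorphisms from the standard symplectic space. -/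
structure SymplecticFrame {n : ℕ} {V : Type*} [AddCommGroup V] [Module ℂ V]
    (σ : SymplecticForm n V) where
  toEquiv : ((Fin n → ℂ) × (Fin n → ℂ)) ≃ₗ[ℂ] V
  map_form : ∀ p q, σ.form (toEquiv p) (toEquiv q) = p.1 ⬝ᵥ q.2 - p.2 ⬝ᵥ q.1

namespace LagrangianGrassmannian

variable {n : ℕ} {V : Type*} [AddCommGroup V] [Module ℂ V] {σ : SymplecticForm n V}

theorem ext_carrier {L M : LagrangianGrassmannian σ} (h : L.carrier = M.carrier) : L = M := by
  cases L; cases M; cases h; rfl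

/-- The Lagrangian subspace `{g (x, S x)}`. -/
noncomputable def ofGraph (g : SymplecticFrame σ) (S : SymMat n) : LagrangianGrassmannian σ where
  carrier := (LinearMap.graph (SymMat.op S : (Fin n → ℂ) →ₗ[ℂ] (Fin n → ℂ))).map g.toEquiv.toLinearMap
  isotropic := by
    rintro _ ⟨p, hp, rfl⟩ _ ⟨q, hq, rfl⟩
    have hp : p.2 = (SymMat.op S) p.1 := hp
    have hq : q.2 = (SymMat.op S) q.1 := hq
    have := g.map_form p q
    simp only [LinearEquiv.coe_coe, this, hp, hq, SymMat.op_symm S p.1 q.1, sub_self]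
  finrank_eq := by
    rw [LinearEquiv.finrank_map_eq, LinearMap.graph_eq_range_prod,
      LinearMap.finrank_range_of_inj]
    · simp
    · intro x y h
      exact congrArg Prod.fst h

theorem mem_ofGraph {g : SymplecticFrame σ} {S : SymMat n} {v : V} :
    v ∈ (ofGraph g S).carrier ↔ ∃ x, v = g.toEquiv (x, SymMat.op S x) := by
  constructor
  · rintro ⟨p, hp, rfl⟩
    have hp : p.2 = (SymMat.op S) p.1 := hp
    exact ⟨p.1, by rw [← hp]; rfl⟩
  · rintro ⟨x, rfl⟩
    exact ⟨(x, SymMat.op S x), rfl, rfl⟩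

theorem ofGraph_injective (g : SymplecticFrame σ) : Function.Injective (ofGraph g) := by
  intro S T h
  apply SymMat.op_injective
  ext1 x
  have : g.toEquiv (x, SymMat.op S x) ∈ (ofGraph g T).carrier := by
    rw [← h]; exact mem_ofGraph.2 ⟨x, rfl⟩
  obtain ⟨y, hy⟩ := mem_ofGraph.1 this
  have := g.toEquiv.injective hy
  simp only [Prod.mk.injEq] at this
  rw [this.2, this.1]

/-- The affine chart of symmetric matrices attached to a symplectic frame. -/
noncomputable def graphChart (g : SymplecticFrame σ) :
    PartialEquiv (LagrangianGrassmannian σ) (SymMat n) where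
  toFun := Function.invFun (ofGraph g)
  invFun := ofGraph g
  source := Set.range (ofGraph g)
  target := Set.univ
  map_source' _ _ := Set.mem_univ _
  map_target' S _ := ⟨S, rfl⟩
  left_inv' := by
    rintro _ ⟨S, rfl⟩
    rw [Function.leftInverse_invFun (ofGraph_injective g) S]
  right_inv' S _ := Function.leftInverse_invFun (ofGraph_injective g) S

theorem graphChart_ofGraph (g : SymplecticFrame σ) (S : SymMat n) :
    graphChart g (ofGraph g S) = S :=
  Function.leftInverse_invFun (ofGraph_injective g) S

/-- The upper left block of the linear symplectic transformation `g'⁻¹ ∘ g`; `blockB`, `blockC`,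
`blockD` are the upper right, lower left and lower right ones. -/
noncomputable def blockA (g g' : SymplecticFrame σ) : (Fin n → ℂ) →L[ℂ] (Fin n → ℂ) :=
  LinearMap.toContinuousLinearMap (LinearMap.fst ℂ _ _ ∘ₗ
    (g.toEquiv.trans g'.toEquiv.symm).toLinearMap ∘ₗ LinearMap.inl ℂ _ _)
/-- See `blockA`. -/
noncomputable def blockB (g g' : SymplecticFrame σ) : (Fin n → ℂ) →L[ℂ] (Fin n → ℂ) :=
  LinearMap.toContinuousLinearMap (LinearMap.fst ℂ _ _ ∘ₗ
    (g.toEquiv.trans g'.toEquiv.symm).toLinearMap ∘ₗ LinearMap.inr ℂ _ _)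
/-- See `blockA`. -/
noncomputable def blockC (g g' : SymplecticFrame σ) : (Fin n → ℂ) →L[ℂ] (Fin n → ℂ) :=
  LinearMap.toContinuousLinearMap (LinearMap.snd ℂ _ _ ∘ₗ
    (g.toEquiv.trans g'.toEquiv.symm).toLinearMap ∘ₗ LinearMap.inl ℂ _ _)
/-- See `blockA`. -/
noncomputable def blockD (g g' : SymplecticFrame σ) : (Fin n → ℂ) →L[ℂ] (Fin n → ℂ) :=
  LinearMap.toContinuousLinearMap (LinearMap.snd ℂ _ _ ∘ₗ
    (g.toEquiv.trans g'.toEquiv.symm).toLinearMap ∘ₗ LinearMap.inr ℂ _ _)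

theorem frame_change (g g' : SymplecticFrame σ) (x y : Fin n → ℂ) :
    g.toEquiv (x, y) =
      g'.toEquiv (blockA g g' x + blockB g g' y, blockC g g' x + blockD g g' y) := by
  rw [← LinearEquiv.symm_apply_eq]
  have : (x, y) = ((x, 0) : (Fin n → ℂ) × (Fin n → ℂ)) + (0, y) := by simp
  rw [this, map_add, map_add]
  ext i <;> simp [blockA, blockB, blockC, blockD]

theorem ofGraph_mem_range_iff (g g' : SymplecticFrame σ) (S : SymMat n) :
    ofGraph g S ∈ Set.range (ofGraph g') ↔ IsUnit (blockA g g' + blockB g g' * (SymMat.op S)) := by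
  have key : ∀ x, g.toEquiv (x, SymMat.op S x) = g'.toEquiv ((blockA g g' + blockB g g' * (SymMat.op S)) x,
      (blockC g g' + blockD g g' * (SymMat.op S)) x) := fun x => by rw [frame_change g g']; rfl
  constructor
  · rintro ⟨T, hT⟩
    have hsurj : Function.Surjective (blockA g g' + blockB g g' * (SymMat.op S)) := by
      intro x
      have : g'.toEquiv (x, SymMat.op T x) ∈ (ofGraph g S).carrier := by
        rw [← hT]; exact mem_ofGraph.2 ⟨x, rfl⟩
      obtain ⟨y, hy⟩ := mem_ofGraph.1 this
      rw [key] at hy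
      exact ⟨y, (congrArg Prod.fst (g'.toEquiv.injective hy)).symm⟩
    have hinj : Function.Injective (blockA g g' + blockB g g' * (SymMat.op S)) :=
      (LinearMap.injective_iff_surjective
        (f := ((blockA g g' + blockB g g' * (SymMat.op S) : (Fin n → ℂ) →L[ℂ] (Fin n → ℂ)) :
          (Fin n → ℂ) →ₗ[ℂ] (Fin n → ℂ)))).2 hsurj
    rw [ContinuousLinearMap.isUnit_iff_bijective]
    exact ⟨hinj, hsurj⟩
  · rintro ⟨u, hu⟩
    have e1 : ∀ x, (u : (Fin n → ℂ) →L[ℂ] (Fin n → ℂ)) ((↑u⁻¹ : (Fin n → ℂ) →L[ℂ] (Fin n → ℂ)) x) = x := by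
      intro x
      have := congrArg (fun f : (Fin n → ℂ) →L[ℂ] (Fin n → ℂ) => f x) u.mul_inv
      exact this
    have e2 : ∀ x, (↑u⁻¹ : (Fin n → ℂ) →L[ℂ] (Fin n → ℂ)) ((u : (Fin n → ℂ) →L[ℂ] (Fin n → ℂ)) x) = x := by
      intro x
      have := congrArg (fun f : (Fin n → ℂ) →L[ℂ] (Fin n → ℂ) => f x) u.inv_mul
      exact this
    have hk : ∀ x, g'.toEquiv (x, ((blockC g g' + blockD g g' * (SymMat.op S)) * ↑u⁻¹) x) ∈
        (ofGraph g S).carrier := by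
      intro x
      refine mem_ofGraph.2 ⟨(↑u⁻¹ : (Fin n → ℂ) →L[ℂ] (Fin n → ℂ)) x, ?_⟩
      rw [key, ← hu, e1]
      rfl
    obtain ⟨T, hT⟩ : ∃ T : SymMat n,
        SymMat.op T = (blockC g g' + blockD g g' * SymMat.op S) * ↑u⁻¹ := by
      apply SymMat.exists_op
      intro x y
      have := (ofGraph g S).isotropic _ (hk x) _ (hk y)
      rw [g'.map_form] at this
      exact sub_eq_zero.1 this
    · refine ⟨T, ?_⟩
      rw [← hT] at hk
      apply ext_carrier
      ext v
      rw [mem_ofGraph]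
      constructor
      · rintro ⟨x, rfl⟩
        exact hk x
      · intro hv
        obtain ⟨x, rfl⟩ := mem_ofGraph.1 hv
        refine ⟨(blockA g g' + blockB g g' * (SymMat.op S)) x, ?_⟩
        rw [key, hT]
        congr 2
        change _ = (blockC g g' + blockD g g' * (SymMat.op S))
          ((↑u⁻¹ : (Fin n → ℂ) →L[ℂ] (Fin n → ℂ)) ((blockA g g' + blockB g g' * (SymMat.op S)) x))
        rw [← hu, e2]

theorem graphChart_change (g g' : SymplecticFrame σ) (S : SymMat n)
    (h : IsUnit (blockA g g' + blockB g g' * (SymMat.op S))) :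
    SymMat.op (graphChart g' (ofGraph g S)) =
      (blockC g g' + blockD g g' * (SymMat.op S)) * Ring.inverse (blockA g g' + blockB g g' * (SymMat.op S)) := by
  obtain ⟨T, hT⟩ := (ofGraph_mem_range_iff g g' S).2 h
  rw [← hT, graphChart_ofGraph]
  have : (SymMat.op T) * (blockA g g' + blockB g g' * (SymMat.op S)) = blockC g g' + blockD g g' * (SymMat.op S) := by
    ext1 x
    have hx : g.toEquiv (x, SymMat.op S x) ∈ (ofGraph g' T).carrier := by
      rw [hT]; exact mem_ofGraph.2 ⟨x, rfl⟩
    obtain ⟨y, hy⟩ := mem_ofGraph.1 hx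
    rw [frame_change g g'] at hy
    have := g'.toEquiv.injective hy
    simp only [Prod.mk.injEq] at this
    change (SymMat.op T) (blockA g g' x + blockB g g' (SymMat.op S x)) = blockC g g' x + blockD g g' (SymMat.op S x)
    rw [this.1, this.2]
  rw [← this, mul_assoc, Ring.mul_inverse_cancel _ h, mul_one]

theorem contDiffOn_graphChart_change (g g' : SymplecticFrame σ) :
    ContDiffOn ℂ ω (fun S => graphChart g' (ofGraph g S))
      {S : SymMat n | IsUnit (blockA g g' + blockB g g' * (SymMat.op S))} := by
  apply SymMat.contDiffOn_of_op
  have h1 : ContDiffOn ℂ ω (fun S : SymMat n => (blockC g g' + blockD g g' * SymMat.op S) *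
      Ring.inverse (blockA g g' + blockB g g' * SymMat.op S))
      {S : SymMat n | IsUnit (blockA g g' + blockB g g' * SymMat.op S)} := by
    intro S hS
    apply ContDiffAt.contDiffWithinAt
    refine ContDiffAt.mul ?_ ?_
    · exact (contDiff_const.add (contDiff_const.mul SymMat.contDiff_op)).contDiffAt
    · obtain ⟨u, hu⟩ := hS
      have := contDiffAt_ringInverse (n := ω) ℂ u
      rw [hu] at this
      exact this.comp S (contDiff_const.add (contDiff_const.mul SymMat.contDiff_op)).contDiffAt
  exact h1.congr fun S hS => graphChart_change g g' S hS

theorem exists_frame [FiniteDimensional ℂ V] (L : LagrangianGrassmannian σ) :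
    ∃ g : SymplecticFrame σ, ofGraph g 0 = L := by
  let u : Basis (Fin n) ℂ L.carrier := finBasisOfFinrankEq ℂ L.carrier L.finrank_eq
  have hu : ∀ i j, σ.form (u i) (u j) = 0 := fun i j => L.isotropic _ (u i).2 _ (u j).2
  have hneg : ∀ x y, σ.form x y = - σ.form y x := fun x y => (LinearMap.IsAlt.neg σ.isAlt y x).symm
  classical
  obtain ⟨v, hv⟩ : ∃ v : Fin n → V, ∀ i j, σ.form (u i) (v j) = if i = j then 1 else 0 := by
    let D := σ.form.toDual σ.nondegenerate
    have hD : ∀ x y, D x y = σ.form x y := fun x y => rfl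
    have hli : LinearIndependent ℂ (fun i => (u i : V)) :=
      u.linearIndependent.map' L.carrier.subtype L.carrier.ker_subtype
    let b := Basis.extend hli.linearIndepOn_id
    have hmem : ∀ i, (u i : V) ∈ hli.linearIndepOn_id.extend (Set.subset_univ _) := fun i =>
      Basis.subset_extend hli.linearIndepOn_id ⟨i, rfl⟩
    refine ⟨fun j => - D.symm (b.coord ⟨u j, hmem j⟩), fun i j => ?_⟩
    rw [map_neg, ← hneg, ← hD, LinearEquiv.apply_symm_apply]
    have : (u i : V) = b ⟨u i, hmem i⟩ :=
      (Basis.extend_apply_self hli.linearIndepOn_id ⟨u i, hmem i⟩).symm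
    rw [this, Basis.coord_apply, Basis.repr_self, Finsupp.single_apply]
    have : ((⟨u i, hmem i⟩ : hli.linearIndepOn_id.extend (Set.subset_univ _)) = ⟨u j, hmem j⟩) ↔ i = j := by
      rw [Subtype.mk.injEq]
      exact hli.injective.eq_iff
    simp only [this]
  let w : Fin n → V := fun j => v j + ∑ k, (-(1 / 2 : ℂ) * σ.form (v j) (v k)) • (u k : V)
  have huw : ∀ i j, σ.form (u i) (w j) = if i = j then 1 else 0 := by
    intro i j
    simp [w, hu, hv]
  have hvu : ∀ i j, σ.form (v i) (u j) = if i = j then -1 else 0 := by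
    intro i j
    rw [hneg, hv]
    by_cases h : i = j
    · simp [h]
    · simp [h, Ne.symm h]
  have hww : ∀ i j, σ.form (w i) (w j) = 0 := by
    intro i j
    simp [w, hu, hv, hvu]
    rw [hneg (v j) (v i)]
    ring
  let G : ((Fin n → ℂ) × (Fin n → ℂ)) →ₗ[ℂ] V :=
    (Fintype.linearCombination ℂ (fun i => (u i : V))).coprod (Fintype.linearCombination ℂ w)
  have hG : ∀ p, G p = ∑ i, p.1 i • (u i : V) + ∑ i, p.2 i • w i := fun p => by
    simp [G, Fintype.linearCombination_apply]
  have hwu : ∀ i j, σ.form (w i) (u j) = if i = j then -1 else 0 := by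
    intro i j
    rw [hneg, huw]
    by_cases h : i = j
    · simp [h]
    · simp [h, Ne.symm h]
  have hform : ∀ p q, σ.form (G p) (G q) = p.1 ⬝ᵥ q.2 - p.2 ⬝ᵥ q.1 := by
    intro p q
    simp [hG, hu, hww, huw, hwu, dotProduct, Finset.sum_neg_distrib, sub_eq_add_neg]
  have hinj : Function.Injective G := by
    rw [← LinearMap.ker_eq_bot, LinearMap.ker_eq_bot']
    intro p hp
    have h0 : ∀ q : (Fin n → ℂ) × (Fin n → ℂ), p.1 ⬝ᵥ q.2 - p.2 ⬝ᵥ q.1 = 0 := by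
      intro q
      rw [← hform, hp]; simp
    ext i
    · simpa using h0 (0, Pi.single i 1)
    · simpa using h0 (Pi.single i 1, 0)
  have hfr : finrank ℂ ((Fin n → ℂ) × (Fin n → ℂ)) = finrank ℂ V := by
    rw [σ.finrank_eq]; simp; ring
  refine ⟨⟨LinearEquiv.ofInjectiveOfFinrankEq G hinj hfr, fun p q => hform p q⟩, ?_⟩
  apply ext_carrier
  ext x
  rw [mem_ofGraph]
  have hx : ∀ y : Fin n → ℂ, G (y, 0) = ((∑ i, y i • u i : L.carrier) : V) := by
    intro y
    simp [hG]
  constructor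
  · rintro ⟨y, rfl⟩
    change G (y, SymMat.op 0 y) ∈ _
    rw [map_zero]
    change G (y, 0) ∈ _
    rw [hx]
    exact Subtype.mem _
  · intro h
    refine ⟨u.repr ⟨x, h⟩, ?_⟩
    change x = G (_, SymMat.op 0 _)
    rw [map_zero]
    change x = G (_, 0)
    rw [hx, u.sum_repr]

/-- A chosen symplectic frame whose first half spans `L`. -/
noncomputable def frameAt [FiniteDimensional ℂ V] (L : LagrangianGrassmannian σ) :
    SymplecticFrame σ :=
  (exists_frame L).choose

theorem ofGraph_frameAt [FiniteDimensional ℂ V] (L : LagrangianGrassmannian σ) :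
    ofGraph (frameAt L) 0 = L :=
  (exists_frame L).choose_spec

theorem graphChart_trans_source (g g' : SymplecticFrame σ) :
    ((graphChart g).symm.trans (graphChart g')).source =
      {S : SymMat n | IsUnit (blockA g g' + blockB g g' * (SymMat.op S))} := by
  ext S
  have := ofGraph_mem_range_iff g g' S
  change S ∈ (Set.univ ∩ ofGraph g ⁻¹' Set.range (ofGraph g')) ↔ _
  rw [Set.univ_inter]
  exact this

/-- The atlas of all affine charts of symmetric matrices. -/
noncomputable def chartedSpaceCore [FiniteDimensional ℂ V] :
    ChartedSpaceCore (SymMat n) (LagrangianGrassmannian σ) where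
  atlas := Set.range graphChart
  chartAt L := graphChart (frameAt L)
  mem_chart_source L := ⟨0, ofGraph_frameAt L⟩
  chart_mem_atlas L := ⟨_, rfl⟩
  open_source := by
    rintro _ _ ⟨g, rfl⟩ ⟨g', rfl⟩
    rw [graphChart_trans_source]
    refine Units.isOpen.preimage (f := fun S : SymMat n => blockA g g' + blockB g g' * (SymMat.op S)) ?_
    exact continuous_const.add (continuous_const.mul SymMat.contDiff_op.continuous)
  continuousOn_toFun := by
    rintro _ _ ⟨g, rfl⟩ ⟨g', rfl⟩
    rw [graphChart_trans_source]
    exact (contDiffOn_graphChart_change g g').continuousOn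

noncomputable instance [FiniteDimensional ℂ V] : TopologicalSpace (LagrangianGrassmannian σ) :=
  chartedSpaceCore.toTopologicalSpace

noncomputable instance [FiniteDimensional ℂ V] :
    ChartedSpace (SymMat n) (LagrangianGrassmannian σ) :=
  chartedSpaceCore.toChartedSpace

theorem mem_atlas_iff [FiniteDimensional ℂ V]
    {e : OpenPartialHomeomorph (LagrangianGrassmannian σ) (SymMat n)} :
    e ∈ atlas (SymMat n) (LagrangianGrassmannian σ) ↔
      ∃ g, e = chartedSpaceCore.openPartialHomeomorph (graphChart g) ⟨g, rfl⟩ := by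
  change e ∈ ⋃ (e : PartialEquiv _ _) (he : e ∈ chartedSpaceCore.atlas),
    {chartedSpaceCore.openPartialHomeomorph e he} ↔ _
  simp only [Set.mem_iUnion, Set.mem_singleton_iff]
  constructor
  · rintro ⟨_, ⟨g, rfl⟩, h⟩
    exact ⟨g, h⟩
  · rintro ⟨g, h⟩
    exact ⟨_, ⟨g, rfl⟩, h⟩

/-- The Lagrangian Grassmannian is a complex manifold. -/
instance [FiniteDimensional ℂ V] :
    IsManifold 𝓘(ℂ, SymMat n) ω (LagrangianGrassmannian σ) := by
  apply isManifold_of_contDiffOn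
  intro e e' he he'
  obtain ⟨g, rfl⟩ := mem_atlas_iff.1 he
  obtain ⟨g', rfl⟩ := mem_atlas_iff.1 he'
  have h := contDiffOn_graphChart_change g g'
  rw [← graphChart_trans_source] at h
  refine h.mono ?_
  intro S hS
  exact hS.1

end LagrangianGrassmannian

namespace LagrangianGrassmannian

variable {n : ℕ} {V : Type*} [AddCommGroup V] [Module ℂ V] {σ : SymplecticForm n V}

/-- The fibre `V / L` of the tautological quotient bundle `Q`. -/
abbrev Quot (L : LagrangianGrassmannian σ) : Type _ := V ⧸ L.carrier

/-- The fibre `⋀ⁿ (V / L)` of the line bundle `𝒪(1) = det Q`. -/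
abbrev DetQuot (L : LagrangianGrassmannian σ) : Type _ := ⋀[ℂ]^n (Quot L)

/-- The fibre `Q_L ⊗ 𝒪(1)_L` of `Q(1)`. -/
def TwistedQuot (L : LagrangianGrassmannian σ) : Type _ := Quot L ⊗[ℂ] DetQuot L

noncomputable instance (L : LagrangianGrassmannian σ) : AddCommGroup (TwistedQuot L) :=
  inferInstanceAs (AddCommGroup (Quot L ⊗[ℂ] DetQuot L))

noncomputable instance (L : LagrangianGrassmannian σ) : Module ℂ (TwistedQuot L) :=
  inferInstanceAs (Module ℂ (Quot L ⊗[ℂ] DetQuot L))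

/-- The usual topology of a finite-dimensional complex vector space. -/
noncomputable instance (L : LagrangianGrassmannian σ) : TopologicalSpace (TwistedQuot L) :=
  moduleTopology ℂ (TwistedQuot L)

instance (L : LagrangianGrassmannian σ) : IsModuleTopology ℂ (TwistedQuot L) := ⟨rfl⟩

/-- The images in `V / L` of the last `n` vectors of a symplectic frame, as a linear map. -/
noncomputable def quotFrame (g : SymplecticFrame σ) (L : LagrangianGrassmannian σ) :
    (Fin n → ℂ) →ₗ[ℂ] Quot L :=
  L.carrier.mkQ ∘ₗ g.toEquiv.toLinearMap ∘ₗ LinearMap.inr ℂ _ _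

/-- If `q₁, …, qₙ` are the images in `V / L` of the last `n` vectors of a symplectic frame, this is
the linear map `y ↦ (∑ yᵢ qᵢ) ⊗ (q₁ ∧ ⋯ ∧ qₙ)`. -/
noncomputable def twistedFrame (g : SymplecticFrame σ) (L : LagrangianGrassmannian σ) :
    (Fin n → ℂ) →ₗ[ℂ] TwistedQuot L :=
  (TensorProduct.mk ℂ (Quot L) (DetQuot L)).flip
    (exteriorPower.ιMulti ℂ n fun i => quotFrame g L (Pi.single i 1)) ∘ₗ quotFrame g L

theorem twistedFrame_apply (g : SymplecticFrame σ) (L : LagrangianGrassmannian σ)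
    (y : Fin n → ℂ) : twistedFrame g L y = (quotFrame g L y) ⊗ₜ[ℂ]
      (exteriorPower.ιMulti ℂ n fun i => quotFrame g L (Pi.single i 1)) := rfl

theorem finrank_quot [FiniteDimensional ℂ V] (L : LagrangianGrassmannian σ) :
    finrank ℂ (Quot L) = n := by
  have := L.carrier.finrank_quotient_add_finrank
  rw [L.finrank_eq, σ.finrank_eq] at this
  change finrank ℂ (V ⧸ L.carrier) = n
  omega

theorem finrank_twistedQuot [FiniteDimensional ℂ V] (L : LagrangianGrassmannian σ) :
    finrank ℂ (TwistedQuot L) = n := by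
  change finrank ℂ (Quot L ⊗[ℂ] DetQuot L) = n
  rw [finrank_tensorProduct, exteriorPower.finrank_eq, finrank_quot]
  simp

instance [FiniteDimensional ℂ V] (L : LagrangianGrassmannian σ) :
    FiniteDimensional ℂ (TwistedQuot L) :=
  inferInstanceAs (FiniteDimensional ℂ (Quot L ⊗[ℂ] DetQuot L))

theorem quotFrame_injective {g : SymplecticFrame σ} {L : LagrangianGrassmannian σ}
    (h : L ∈ Set.range (ofGraph g)) : Function.Injective (quotFrame g L) := by
  obtain ⟨S, rfl⟩ := h
  rw [← LinearMap.ker_eq_bot, LinearMap.ker_eq_bot']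
  intro y hy
  have hy : g.toEquiv (0, y) ∈ (ofGraph g S).carrier :=
    (Submodule.Quotient.mk_eq_zero _).1 hy
  obtain ⟨x, hx⟩ := mem_ofGraph.1 hy
  have := g.toEquiv.injective hx
  simp only [Prod.mk.injEq] at this
  rw [this.2, ← this.1, map_zero]

theorem twistedFrame_injective [FiniteDimensional ℂ V] {g : SymplecticFrame σ}
    {L : LagrangianGrassmannian σ} (h : L ∈ Set.range (ofGraph g)) :
    Function.Injective (twistedFrame g L) := by
  let e : (Fin n → ℂ) ≃ₗ[ℂ] Quot L := LinearEquiv.ofInjectiveOfFinrankEq (quotFrame g L)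
    (quotFrame_injective h) (by rw [finrank_quot]; simp)
  let b : Basis (Fin n) ℂ (Quot L) := Basis.ofEquivFun e.symm
  have hb : ∀ i, b i = quotFrame g L (Pi.single i 1) := fun i => by
    simp [b, e]
    rfl
  let D : DetQuot L →ₗ[ℂ] ℂ := exteriorPower.alternatingMapLinearEquiv b.det
  let R : TwistedQuot L →ₗ[ℂ] Quot L :=
    (TensorProduct.rid ℂ (Quot L)).toLinearMap ∘ₗ TensorProduct.map LinearMap.id D
  have hR : ∀ y, R (twistedFrame g L y) = quotFrame g L y := by
    intro y
    have hD : D (exteriorPower.ιMulti ℂ n fun i => quotFrame g L (Pi.single i 1)) = 1 := by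
      have : (fun i => quotFrame g L (Pi.single i 1)) = ⇑b := funext fun i => (hb i).symm
      rw [this]
      simp only [D, exteriorPower.alternatingMapLinearEquiv_apply_ιMulti]
      exact b.det_self
    change (TensorProduct.rid ℂ (Quot L)) (TensorProduct.map LinearMap.id D
      (quotFrame g L y ⊗ₜ[ℂ] _)) = _
    rw [TensorProduct.map_tmul, TensorProduct.rid_tmul, hD, one_smul]
    rfl
  intro y z hyz
  apply quotFrame_injective h
  rw [← hR, hyz, hR]

/-- `twistedFrame g L` as an isomorphism, for `L` in the affine chart of `g`. -/
noncomputable def twistedEquiv [FiniteDimensional ℂ V] (g : SymplecticFrame σ)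
    (L : LagrangianGrassmannian σ) (h : L ∈ Set.range (ofGraph g)) :
    (Fin n → ℂ) ≃ₗ[ℂ] TwistedQuot L :=
  LinearEquiv.ofInjectiveOfFinrankEq (twistedFrame g L) (twistedFrame_injective h)
    (by rw [finrank_twistedQuot]; simp)

theorem twistedEquiv_apply [FiniteDimensional ℂ V] {g : SymplecticFrame σ}
    {L : LagrangianGrassmannian σ} (h : L ∈ Set.range (ofGraph g)) (y : Fin n → ℂ) :
    twistedEquiv g L h y = twistedFrame g L y := rfl

theorem isOpen_range_ofGraph [FiniteDimensional ℂ V] (g : SymplecticFrame σ) :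
    IsOpen (Set.range (ofGraph g)) :=
  chartedSpaceCore.open_source' (e := graphChart g) ⟨g, rfl⟩

open Classical in
/-- The trivialization of `Q(1)` over the affine chart of `g` given by `twistedFrame g`. -/
noncomputable def twistedPretriv [FiniteDimensional ℂ V] (g : SymplecticFrame σ) :
    Pretrivialization (Fin n → ℂ)
      (π (Fin n → ℂ) (TwistedQuot : LagrangianGrassmannian σ → Type _)) where
  toFun t := (t.1, if h : t.1 ∈ Set.range (ofGraph g) then (twistedEquiv g t.1 h).symm t.2 else 0)
  invFun p := ⟨p.1, twistedFrame g p.1 p.2⟩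
  source := π (Fin n → ℂ) TwistedQuot ⁻¹' Set.range (ofGraph g)
  target := Set.range (ofGraph g) ×ˢ Set.univ
  baseSet := Set.range (ofGraph g)
  map_source' t ht := ⟨ht, Set.mem_univ _⟩
  map_target' p hp := hp.1
  left_inv' := by
    rintro ⟨L, t⟩ h
    have h : L ∈ Set.range (ofGraph g) := h
    simp only [dif_pos h]
    rw [← twistedEquiv_apply h, LinearEquiv.apply_symm_apply]
  right_inv' := by
    rintro ⟨L, y⟩ h
    have h : L ∈ Set.range (ofGraph g) := h.1
    simp only [dif_pos h]
    rw [← twistedEquiv_apply h, LinearEquiv.symm_apply_apply]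
  open_target := (isOpen_range_ofGraph g).prod isOpen_univ
  open_baseSet := isOpen_range_ofGraph g
  source_eq := rfl
  target_eq := rfl
  proj_toFun _ _ := rfl

theorem twistedPretriv_apply [FiniteDimensional ℂ V] {g : SymplecticFrame σ}
    {L : LagrangianGrassmannian σ} (h : L ∈ Set.range (ofGraph g)) (t : TwistedQuot L) :
    (twistedPretriv g ⟨L, t⟩).2 = (twistedEquiv g L h).symm t :=
  dif_pos h

theorem twistedPretriv_symm [FiniteDimensional ℂ V] {g : SymplecticFrame σ}
    {L : LagrangianGrassmannian σ} (h : L ∈ Set.range (ofGraph g)) (y : Fin n → ℂ) :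
    (twistedPretriv g).symm L y = twistedFrame g L y := by
  rw [Pretrivialization.symm_apply _ h]
  rfl

/-- The change of frames of `Q` from `g` to `g'`, at `L`. -/
noncomputable def quotChange (g g' : SymplecticFrame σ) (L : LagrangianGrassmannian σ) :
    (Fin n → ℂ) →L[ℂ] (Fin n → ℂ) :=
  blockD g g' - SymMat.op (graphChart g' L) * blockB g g'

theorem quotFrame_change (g g' : SymplecticFrame σ) {L : LagrangianGrassmannian σ}
    (h : L ∈ Set.range (ofGraph g')) (y : Fin n → ℂ) :
    quotFrame g L y = quotFrame g' L (quotChange g g' L y) := by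
  obtain ⟨S, rfl⟩ := h
  refine (Submodule.Quotient.eq _).2 ?_
  refine mem_ofGraph.2 ⟨blockB g g' y, ?_⟩
  change g.toEquiv (0, y) - g'.toEquiv (0, quotChange g g' _ y) = _
  rw [frame_change g g', ← map_sub]
  congr 1
  simp [quotChange, graphChart_ofGraph]

theorem twistedFrame_change [FiniteDimensional ℂ V] (g g' : SymplecticFrame σ)
    {L : LagrangianGrassmannian σ} (h : L ∈ Set.range (ofGraph g')) (y : Fin n → ℂ) :
    twistedFrame g L y =
      twistedFrame g' L (((quotChange g g' L).det • quotChange g g' L) y) := by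
  have hdet : (exteriorPower.ιMulti ℂ n fun i => quotFrame g L (Pi.single i 1)) =
      (quotChange g g' L).det •
        exteriorPower.ιMulti ℂ n fun i => quotFrame g' L (Pi.single i 1) := by
    let f : (Fin n → ℂ) [⋀^Fin n]→ₗ[ℂ] DetQuot L :=
      (exteriorPower.ιMulti ℂ n).compLinearMap (quotFrame g' L)
    let b := Pi.basisFun ℂ (Fin n)
    have hf : f = (LinearMap.toSpanSingleton ℂ _ (f b)).compAlternatingMap b.det := by
      refine Basis.ext_alternating b fun i hi => ?_
      let τ : Equiv.Perm (Fin n) := Equiv.ofBijective i (Finite.injective_iff_bijective.1 hi)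
      change f (b ∘ τ) = LinearMap.toSpanSingleton ℂ _ (f b) (b.det (b ∘ τ))
      rw [AlternatingMap.map_perm, AlternatingMap.map_perm, Basis.det_self,
        LinearMap.map_smul_of_tower, LinearMap.toSpanSingleton_apply, one_smul]
    have hfT : f ((quotChange g g' L).toLinearMap ∘ b) =
        (quotChange g g' L).det • f b := by
      conv_lhs => rw [hf]
      rw [LinearMap.compAlternatingMap_apply, Basis.det_comp, Basis.det_self, mul_one,
        LinearMap.toSpanSingleton_apply]
    have hb : ∀ i, b i = Pi.single i 1 := fun i => Pi.basisFun_apply ℂ (Fin n) i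
    simp only [quotFrame_change g g' h]
    have e1 : f b = exteriorPower.ιMulti ℂ n fun i => quotFrame g' L (Pi.single i 1) := by
      simp only [f, AlternatingMap.compLinearMap_apply, hb]
    have e2 : f ((quotChange g g' L).toLinearMap ∘ b) = exteriorPower.ιMulti ℂ n
        fun i => quotFrame g' L (quotChange g g' L (Pi.single i 1)) := by
      simp only [f, AlternatingMap.compLinearMap_apply, hb, Function.comp_apply]
      rfl
    rw [← e1, ← e2, hfT]
  rw [twistedFrame_apply, twistedFrame_apply, hdet, quotFrame_change g g' h y,
    TensorProduct.tmul_smul, TensorProduct.smul_tmul', ← map_smul]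
  rfl

theorem contMDiffOn_quotChange [FiniteDimensional ℂ V] (g g' : SymplecticFrame σ) :
    ContMDiffOn 𝓘(ℂ, SymMat n) 𝓘(ℂ, (Fin n → ℂ) →L[ℂ] (Fin n → ℂ)) ω
      (fun L => (quotChange g g' L).det • quotChange g g' L) (Set.range (ofGraph g')) := by
  have hc : ContMDiffOn 𝓘(ℂ, SymMat n) 𝓘(ℂ, SymMat n) ω
      (graphChart g' : LagrangianGrassmannian σ → SymMat n) (Set.range (ofGraph g')) :=
    contMDiffOn_of_mem_maximalAtlas (I := 𝓘(ℂ, SymMat n)) (n := ω)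
      (e := chartedSpaceCore.openPartialHomeomorph (graphChart g') ⟨g', rfl⟩)
      (IsManifold.subset_maximalAtlas (mem_atlas_iff.2 ⟨g', rfl⟩))
  have h1 : ContDiff ℂ ω (fun S : SymMat n => blockD g g' - SymMat.op S * blockB g g') :=
    contDiff_const.sub (SymMat.contDiff_op.mul contDiff_const)
  have h2 : ContDiff ℂ ω (fun S : SymMat n => (blockD g g' - SymMat.op S * blockB g g').det) := by
    have : ∀ T : (Fin n → ℂ) →L[ℂ] (Fin n → ℂ), T.det = ∑ τ : Equiv.Perm (Fin n),
        ((Equiv.Perm.sign τ : ℤ) : ℂ) * ∏ i, T (Pi.single i 1) (τ i) := by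
      intro T
      rw [ContinuousLinearMap.det, ← LinearMap.det_toMatrix', Matrix.det_apply']
      rfl
    simp only [this]
    refine ContDiff.sum fun τ _ => contDiff_const.mul (contDiff_prod fun i _ => ?_)
    exact contDiff_pi.1 (h1.clm_apply contDiff_const) (τ i)
  exact (h2.smul h1).contMDiff.comp_contMDiffOn hc

/-- The holomorphic vector bundle structure of `Q(1)`. -/
noncomputable def twistedPrebundle [FiniteDimensional ℂ V] :
    VectorPrebundle ℂ (Fin n → ℂ) (TwistedQuot : LagrangianGrassmannian σ → Type _) where
  pretrivializationAtlas := Set.range twistedPretriv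
  pretrivialization_linear' := by
    rintro _ ⟨g, rfl⟩
    refine ⟨fun L hL => ?_⟩
    have hL : L ∈ Set.range (ofGraph g) := hL
    simp only [twistedPretriv_apply hL]
    exact (twistedEquiv g L hL).symm.toLinearMap.isLinear
  pretrivializationAt L := twistedPretriv (frameAt L)
  mem_base_pretrivializationAt L := ⟨0, ofGraph_frameAt L⟩
  pretrivialization_mem_atlas L := ⟨_, rfl⟩
  exists_coordChange := by
    rintro _ ⟨g, rfl⟩ _ ⟨g', rfl⟩
    refine ⟨fun L => (quotChange g g' L).det • quotChange g g' L,
      (contMDiffOn_quotChange g g').continuousOn.mono fun L hL => hL.2, ?_⟩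
    rintro L ⟨hL, hL'⟩ y
    rw [twistedPretriv_symm hL, twistedPretriv_apply hL', twistedFrame_change g g' hL',
      ← twistedEquiv_apply hL', LinearEquiv.symm_apply_apply]
  totalSpaceMk_isInducing L := by
    have hL : L ∈ Set.range (ofGraph (frameAt L)) := ⟨0, ofGraph_frameAt L⟩
    have h1 : twistedPretriv (frameAt L) ∘ TotalSpace.mk L =
        fun t => (L, (twistedEquiv (frameAt L) L hL).symm t) := by
      funext t
      exact Prod.ext rfl (twistedPretriv_apply hL t)
    rw [h1]
    refine Topology.isInducing_const_prod.2 ?_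
    have := IsModuleTopology.toContinuousAdd ℂ (TwistedQuot L)
    let e : TwistedQuot L ≃L[ℂ] (Fin n → ℂ) :=
      { (twistedEquiv (frameAt L) L hL).symm with
        continuous_toFun := IsModuleTopology.continuous_of_linearMap
          (twistedEquiv (frameAt L) L hL).symm.toLinearMap
        continuous_invFun := IsModuleTopology.continuous_of_linearMap
          (twistedEquiv (frameAt L) L hL).toLinearMap }
    exact e.toHomeomorph.isInducing

instance [FiniteDimensional ℂ V] : (twistedPrebundle (σ := σ)).IsContMDiff 𝓘(ℂ, SymMat n) ω where
  exists_contMDiffCoordChange := by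
    rintro _ ⟨g, rfl⟩ _ ⟨g', rfl⟩
    refine ⟨fun L => (quotChange g g' L).det • quotChange g g' L,
      (contMDiffOn_quotChange g g').mono fun L hL => hL.2, ?_⟩
    rintro L ⟨hL, hL'⟩ y
    rw [twistedPretriv_symm hL, twistedPretriv_apply hL', twistedFrame_change g g' hL',
      ← twistedEquiv_apply hL', LinearEquiv.symm_apply_apply]

noncomputable instance [FiniteDimensional ℂ V] : TopologicalSpace
    (TotalSpace (Fin n → ℂ) (TwistedQuot : LagrangianGrassmannian σ → Type _)) :=
  twistedPrebundle.totalSpaceTopology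

noncomputable instance [FiniteDimensional ℂ V] :
    FiberBundle (Fin n → ℂ) (TwistedQuot : LagrangianGrassmannian σ → Type _) :=
  twistedPrebundle.toFiberBundle

instance [FiniteDimensional ℂ V] :
    VectorBundle ℂ (Fin n → ℂ) (TwistedQuot : LagrangianGrassmannian σ → Type _) :=
  twistedPrebundle.toVectorBundle

instance [FiniteDimensional ℂ V] : ContMDiffVectorBundle ω (Fin n → ℂ)
    (TwistedQuot : LagrangianGrassmannian σ → Type _) 𝓘(ℂ, SymMat n) :=
  twistedPrebundle.contMDiffVectorBundle 𝓘(ℂ, SymMat n)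

end LagrangianGrassmannian

section Nakano

variable {EB : Type*} [NormedAddCommGroup EB] [NormedSpace ℂ EB]
  {M : Type*} [TopologicalSpace M] [ChartedSpace EB M]
  {F : Type*} [NormedAddCommGroup F] [NormedSpace ℂ F]
  {E : M → Type*} [TopologicalSpace (TotalSpace F E)] [∀ x, AddCommGroup (E x)]
  [∀ x, Module ℂ (E x)] [∀ x, TopologicalSpace (E x)] [FiberBundle F E]

/-- The derivative `∂f(z)` in direction `v`, i.e. `∂f/∂z_j` if `v` is the `j`-th basis vector. -/
noncomputable def dHol (f : EB → ℂ) (v : EB) (z : EB) : ℂ :=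
  (fderiv ℝ f z v - Complex.I * fderiv ℝ f z (Complex.I • v)) / 2

/-- The derivative `∂̄f(z)` in direction `v`, i.e. `∂f/∂z̄_j` if `v` is the `j`-th basis vector. -/
noncomputable def dAntihol (f : EB → ℂ) (v : EB) (z : EB) : ℂ :=
  (fderiv ℝ f z v + Complex.I * fderiv ℝ f z (Complex.I • v)) / 2

/-- The Gram matrix `H_{λμ} = ⟨e_λ, e_μ⟩` of a family of sections, in a chart `φ`. The forms `h x`
are antilinear in their first argument, whereas `⟨e_λ, e_μ⟩` is linear in `e_λ`. -/
noncomputable def gramMatrix (h : (x : M) → E x →ₗ⋆[ℂ] E x →ₗ[ℂ] ℂ)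
    (φ : OpenPartialHomeomorph M EB) {r : ℕ} (e : Fin r → (x : M) → E x) (z : EB) :
    Matrix (Fin r) (Fin r) ℂ :=
  Matrix.of fun l m => h (φ.symm z) (e m (φ.symm z)) (e l (φ.symm z))

/-- The connection form `θ = ∂H · H⁻¹` of the Chern connection, in direction `v`:
`D e_λ = ∑ θ_{λμ} ⊗ e_μ`. -/
noncomputable def chernForm {r : ℕ} (H : EB → Matrix (Fin r) (Fin r) ℂ) (v : EB) (z : EB) :
    Matrix (Fin r) (Fin r) ℂ :=
  (Matrix.of fun l m => dHol (fun y => H y l m) v z) * (H z)⁻¹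

/-- The curvature `Θ = ∂̄θ` of the Chern connection: if `v`, `w` are the `j`-th and `k`-th basis
vectors, this is the coefficient of `dz_j ∧ dz̄_k`, with `Θ e_λ = ∑ Θ_{λμ} ⊗ e_μ`. -/
noncomputable def chernCurvature {r : ℕ} (H : EB → Matrix (Fin r) (Fin r) ℂ) (v w : EB) (z : EB) :
    Matrix (Fin r) (Fin r) ℂ :=
  Matrix.of fun l m => - dAntihol (fun y => chernForm H v y l m) w z

variable (F) in
/-- `h` is a smooth hermitian metric on the holomorphic vector bundle `E`. -/
structure IsHermitianMetric (h : (x : M) → E x →ₗ⋆[ℂ] E x →ₗ[ℂ] ℂ) : Prop where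
  conj_symm : ∀ x v w, starRingEnd ℂ (h x v w) = h x w v
  pos : ∀ x v, v ≠ 0 → 0 < (h x v v).re
  smooth : ∀ φ ∈ IsManifold.maximalAtlas 𝓘(ℂ, EB) ω M, ∀ (r : ℕ) (e : Fin r → (x : M) → E x)
    (U : Set M), IsOpen U → IsLocalFrameOn 𝓘(ℂ, EB) F ω e U →
    ∀ l m, ContDiffOn ℝ ∞ (fun z => gramMatrix h φ e z l m) (φ.target ∩ φ.symm ⁻¹' U)

variable (F) in
/-- The hermitian metric `h` on the holomorphic vector bundle `E` is Nakano positive: at every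
point, in all local holomorphic coordinates `(z_j)` (a chart followed by a linear coordinate
system `b` of the model space) and all local holomorphic frames `(e_λ)`, the form
`Θ(u) = ∑ ⟨Θ_{j k̄} e_λ, e_μ⟩ u_{jλ} ū_{kμ}` on `TM ⊗ E` is a positive definite hermitian form,
where `u = ∑ u_{jλ} ∂/∂z_j ⊗ e_λ`. -/
def IsNakanoPositive (h : (x : M) → E x →ₗ⋆[ℂ] E x →ₗ[ℂ] ℂ) : Prop :=
  ∀ (x : M), ∀ φ ∈ IsManifold.maximalAtlas 𝓘(ℂ, EB) ω M, x ∈ φ.source →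
    ∀ (N : ℕ) (b : Basis (Fin N) ℂ EB) (r : ℕ) (e : Fin r → (x : M) → E x) (U : Set M),
    IsOpen U → x ∈ U → IsLocalFrameOn 𝓘(ℂ, EB) F ω e U →
    let H := gramMatrix h φ e
    let c := fun (j k : Fin N) => chernCurvature H (b j) (b k) (φ x) * H (φ x)
    (∀ j k l m, c j k l m = starRingEnd ℂ (c k j m l)) ∧
    ∀ u : Fin N → Fin r → ℂ, u ≠ 0 →
      0 < (∑ j, ∑ k, ∑ l, ∑ m, c j k l m * u j l * starRingEnd ℂ (u k m)).re

end Nakano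

namespace LagrangianGrassmannian

variable {n : ℕ} {V : Type*} [NormedAddCommGroup V] [InnerProductSpace ℂ V]
  [FiniteDimensional ℂ V] {σ : SymplecticForm n V}

/-- The identification of `V / L` with the orthogonal complement of `L`. -/
noncomputable def quotProj (L : LagrangianGrassmannian σ) : Quot L →ₗ[ℂ] L.carrierᗮ :=
  L.carrier.liftQ (L.carrierᗮ.orthogonalProjectionOnto : V →ₗ[ℂ] L.carrierᗮ) (by
    intro v hv
    exact Submodule.orthogonalProjectionOnto_eq_zero_iff.2
      (L.carrier.le_orthogonal_orthogonal hv))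

/-- The quotient metric on `V / L`. -/
noncomputable def quotMetric (L : LagrangianGrassmannian σ) :
    Quot L →ₗ⋆[ℂ] Quot L →ₗ[ℂ] ℂ :=
  ((innerₛₗ ℂ (E := L.carrierᗮ)).comp (quotProj L)).compl₂ (quotProj L)

theorem finrank_orthogonal (L : LagrangianGrassmannian σ) : finrank ℂ L.carrierᗮ = n := by
  have := L.carrier.finrank_add_finrank_orthogonal
  rw [L.finrank_eq, σ.finrank_eq] at this
  omega

/-- An orthonormal basis of the orthogonal complement of `L`. -/
noncomputable def orthoBasis (L : LagrangianGrassmannian σ) :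
    OrthonormalBasis (Fin n) ℂ L.carrierᗮ :=
  (stdOrthonormalBasis ℂ L.carrierᗮ).reindex (finCongr (finrank_orthogonal L))

/-- The linear form on `⋀ⁿ (V / L)` with value `1` on `e₁ ∧ ⋯ ∧ eₙ` for the chosen orthonormal
basis `e` of `V / L`. -/
noncomputable def detForm (L : LagrangianGrassmannian σ) : DetQuot L →ₗ[ℂ] ℂ :=
  exteriorPower.alternatingMapLinearEquiv
    ((orthoBasis L).toBasis.det.compLinearMap (quotProj L))

/-- The isometry `Q_L ⊗ 𝒪(1)_L → Lᗮ` given by a unit vector of `𝒪(1)_L`. -/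
noncomputable def twistedProj (L : LagrangianGrassmannian σ) : TwistedQuot L →ₗ[ℂ] L.carrierᗮ :=
  (TensorProduct.rid ℂ L.carrierᗮ).toLinearMap ∘ₗ TensorProduct.map (quotProj L) (detForm L)

/-- The metric on `Q(1) = Q ⊗ det Q` induced by the quotient metric of `Q`. It is characterized by
`twistedMetric_tmul_ιMulti`. -/
noncomputable def twistedMetric (L : LagrangianGrassmannian σ) :
    TwistedQuot L →ₗ⋆[ℂ] TwistedQuot L →ₗ[ℂ] ℂ :=
  ((innerₛₗ ℂ (E := L.carrierᗮ)).comp (twistedProj L)).compl₂ (twistedProj L)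

theorem twistedMetric_tmul_ιMulti (L : LagrangianGrassmannian σ) (p q : Quot L)
    (v w : Fin n → Quot L) :
    twistedMetric L (p ⊗ₜ[ℂ] exteriorPower.ιMulti ℂ n v : Quot L ⊗[ℂ] DetQuot L)
        (q ⊗ₜ[ℂ] exteriorPower.ιMulti ℂ n w : Quot L ⊗[ℂ] DetQuot L) =
      quotMetric L p q * Matrix.det (Matrix.of fun i j => quotMetric L (v i) (w j)) := by
  have hD : ∀ v : Fin n → Quot L, detForm L (exteriorPower.ιMulti ℂ n v) =
      ((orthoBasis L).toBasis.toMatrix fun i => quotProj L (v i)).det := by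
    intro v
    rw [detForm, exteriorPower.alternatingMapLinearEquiv_apply_ιMulti]
    rfl
  have hT : ∀ (p : Quot L) (v : Fin n → Quot L),
      twistedProj L (p ⊗ₜ[ℂ] exteriorPower.ιMulti ℂ n v : Quot L ⊗[ℂ] DetQuot L) =
      detForm L (exteriorPower.ιMulti ℂ n v) • quotProj L p := by
    intro p v
    rfl
  have hM : (Matrix.of fun i j => quotMetric L (v i) (w j)) =
      ((orthoBasis L).toBasis.toMatrix fun i => quotProj L (v i)).conjTranspose *
        ((orthoBasis L).toBasis.toMatrix fun i => quotProj L (w i)) := by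
    ext i j
    rw [Matrix.mul_apply]
    change inner ℂ (quotProj L (v i)) (quotProj L (w j)) = _
    rw [← (orthoBasis L).sum_inner_mul_inner]
    refine Finset.sum_congr rfl fun k _ => ?_
    rw [Matrix.conjTranspose_apply, Basis.toMatrix_apply, Basis.toMatrix_apply,
      OrthonormalBasis.coe_toBasis_repr_apply, OrthonormalBasis.coe_toBasis_repr_apply,
      OrthonormalBasis.repr_apply_apply, OrthonormalBasis.repr_apply_apply, ← inner_conj_symm]
    rfl
  change inner ℂ (twistedProj L _) (twistedProj L _) = inner ℂ (quotProj L p) (quotProj L q) * _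
  rw [hM, hT, hT, inner_smul_left, inner_smul_right, Matrix.det_mul, Matrix.det_conjTranspose, hD,
    hD]
  change (starRingEnd ℂ) _ * _ = _ * ((starRingEnd ℂ) _ * _)
  ring

end LagrangianGrassmannian

/-! Near a point `L`, a symplectic frame `g` with `ofGraph g 0 = L` describes Lagrangian subspaces
as graphs of symmetric matrices `S`. Instead of projecting the frame of `Q` orthogonally, one uses
duality: the Riesz representatives of `σ(l, ·)`, for `l` in a Lagrangian subspace, lie in its
orthogonal complement, and those of the vectors `g (eᵢ, S eᵢ)` form the basis dual to the projected
frame of `Q`. Their transposed Gram matrix `K = a + bS + Sᴴ(bᴴ + dS)` is explicit in `S`, and the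
metric of `Q` is `K⁻¹`. Hence any local holomorphic frame of `Q(1)` has Gram matrix `(det K)⁻¹ A K⁻¹
Aᴴ` with `A` holomorphic (`twistedMetric_twistedFrame`, `gramMatrix_twistedMetric`).

At the point where `S = 0`, the curvature form is `(det a)⁻¹ A (tr Y + Y) a⁻¹ Aᴴ` with `Y = a⁻¹ tᴴ D
s`, where `s`, `t` are the derivatives of `S` in the two directions and `D = d - bᴴ a⁻¹ b` is a
Schur complement, positive definite like `a` (`chernCurvature_mul_of_graphGram`,
`posDef_schurGram`). No normal frame is needed.

After factoring `a⁻¹ = p pᴴ` and `D = dᴴ d` (this `d` being a new matrix), the vector `u` becomes a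
tensor with three indices. The trace term is its squared norm, and the other term pairs it with the
tensor whose outer indices are exchanged. Together they give half a sum of squares, which vanishes
only on tensors antisymmetric in the outer indices. Here the Lagrangian condition enters: tangent
vectors are symmetric matrices, so the tensor, once `p` and `d` are removed, is also symmetric in
its last two indices. Both symmetries together force it to be zero (`twistedCurvature_pos`). -/

section NakanoAlgebra

/-! ### Linear algebra of the curvature form and its positivity. -/

/-- A hermitian form whose coefficients are `Z Zᴴ + Z P Zᴴ`, for `P` the permutation matrix of an
involution, is half a sum of squares. -/
theorem re_sum_involution_form {ι κ : Type*} [Fintype ι] [Fintype κ] (s : Equiv.Perm κ)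
    (hs : ∀ t, s (s t) = t) (Z : ι → κ → ℂ) (w : ι → ℂ) :
    (∑ α, ∑ β, (∑ t, Z α t * starRingEnd ℂ (Z β t + Z β (s t))) * w α * starRingEnd ℂ (w β)).re =
      (∑ t, Complex.normSq ((∑ α, w α * Z α t) + ∑ α, w α * Z α (s t))) / 2 := by
  set ζ : κ → ℂ := fun t => ∑ α, w α * Z α t with hζ
  have h1 : ∑ α, ∑ β, (∑ t, Z α t * starRingEnd ℂ (Z β t + Z β (s t))) * w α *
      starRingEnd ℂ (w β) = ∑ t, ζ t * starRingEnd ℂ (ζ t + ζ (s t)) := by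
    have h2 : ∀ t, ζ t * starRingEnd ℂ (ζ t + ζ (s t)) = ∑ α, ∑ β,
        Z α t * starRingEnd ℂ (Z β t + Z β (s t)) * w α * starRingEnd ℂ (w β) := by
      intro t
      simp only [hζ]
      rw [← Finset.sum_add_distrib, map_sum, Finset.sum_mul_sum]
      refine Finset.sum_congr rfl fun α _ => Finset.sum_congr rfl fun β _ => ?_
      simp only [map_add, map_mul]
      ring
    simp only [h2, Finset.sum_mul]
    rw [Finset.sum_comm (s := (Finset.univ : Finset κ))]
    refine Finset.sum_congr rfl fun α _ => ?_
    rw [Finset.sum_comm]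
  -- The second factor is invariant under `s`, so `ζ t` may be replaced by `ζ (s t)`; adding the two
  -- expressions produces squares.
  have h3 : ∑ t, ζ t * starRingEnd ℂ (ζ t + ζ (s t)) =
      ∑ t, ζ (s t) * starRingEnd ℂ (ζ t + ζ (s t)) := by
    rw [← Equiv.sum_comp s]
    refine Finset.sum_congr rfl fun t _ => ?_
    rw [hs, add_comm (ζ t)]
  have h4 : 2 * ∑ t, ζ t * starRingEnd ℂ (ζ t + ζ (s t)) =
      ∑ t, ((Complex.normSq (ζ t + ζ (s t)) : ℝ) : ℂ) := by
    rw [two_mul]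
    nth_rewrite 2 [h3]
    rw [← Finset.sum_add_distrib]
    refine Finset.sum_congr rfl fun t _ => ?_
    rw [← add_mul, Complex.mul_conj]
  rw [h1]
  have h5 := congrArg Complex.re h4
  rw [← Complex.ofReal_sum, Complex.ofReal_re, Complex.mul_re] at h5
  simp only [Complex.re_ofNat, Complex.im_ofNat, zero_mul, sub_zero] at h5
  change _ = (∑ t, Complex.normSq (ζ t + ζ (s t))) / 2
  linarith

/-- A trilinear array that is symmetric in two indices and antisymmetric in two others vanishes. -/
theorem eq_zero_of_symm_of_antisymm {ι : Type*} {X : ι → ι → ι → ℂ}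
    (h1 : ∀ i j k, X i j k = X i k j) (h2 : ∀ i j k, X i j k = -X k j i) (i j k : ι) :
    X i j k = 0 := by
  -- The transpositions `(1 3)` and `(2 3)`, alternated three times each, compose to the identity,
  -- while the sign changes three times.
  have : X i j k = -X i j k := by
    calc X i j k = -X k j i := h2 _ _ _
      _ = -X k i j := by rw [h1]
      _ = X j i k := by rw [h2 k i j, neg_neg]
      _ = X j k i := h1 _ _ _
      _ = -X i k j := h2 _ _ _
      _ = -X i j k := by rw [h1]
  exact self_eq_neg.1 this

/-- The coefficient matrix of the curvature form of a quotient bundle twisted by its determinant: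
`A (tr Y + Y) a⁻¹ Aᴴ` with `Y = a⁻¹ tᴴ D s`. -/
noncomputable def twistedCurvature {n r : ℕ} (a D : Matrix (Fin n) (Fin n) ℂ)
    (A : Matrix (Fin r) (Fin n) ℂ) (s t : Matrix (Fin n) (Fin n) ℂ) :
    Matrix (Fin r) (Fin r) ℂ :=
  A * ((a⁻¹ * tᴴ * D * s).trace • a⁻¹ + a⁻¹ * tᴴ * D * s * a⁻¹) * Aᴴ

variable {n r : ℕ} {a D : Matrix (Fin n) (Fin n) ℂ}

/-- This is the hermitian symmetry of the curvature form. The trace is moved to the other order of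
directions by cyclicity. -/
theorem twistedCurvature_conjTranspose (ha : a.IsHermitian) (hD : D.IsHermitian)
    (A : Matrix (Fin r) (Fin n) ℂ) (s t : Matrix (Fin n) (Fin n) ℂ) :
    (twistedCurvature a D A s t)ᴴ = twistedCurvature a D A t s := by
  have hai : (a⁻¹)ᴴ = a⁻¹ := ha.inv
  have htr : star (a⁻¹ * tᴴ * D * s).trace = (a⁻¹ * sᴴ * D * t).trace := by
    rw [← Matrix.trace_conjTranspose]
    simp only [Matrix.conjTranspose_mul, Matrix.conjTranspose_conjTranspose, hai, hD.eq]
    rw [← Matrix.mul_assoc, ← Matrix.mul_assoc, Matrix.trace_mul_comm]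
    simp only [Matrix.mul_assoc]
  simp only [twistedCurvature, Matrix.conjTranspose_mul, Matrix.conjTranspose_add,
    Matrix.conjTranspose_smul, htr]
  simp only [Matrix.conjTranspose_conjTranspose, hai, hD.eq,
    Matrix.mul_assoc]

/-- The factorizations split the coefficient into a tensor `Z` attached to `(s, l)` and the
conjugate of one attached to `(t, m)`. The trace term pairs equal indices; the other term pairs `Z`
with its copy in which the two outer indices are exchanged. This is the shape required by
`re_sum_involution_form`. -/
theorem twistedCurvature_apply (p d : Matrix (Fin n) (Fin n) ℂ) (A : Matrix (Fin r) (Fin n) ℂ)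
    (hp : a⁻¹ = p * pᴴ) (hd : D = dᴴ * d) (s t : Matrix (Fin n) (Fin n) ℂ) (l m : Fin r) :
    twistedCurvature a D A s t l m = ∑ x : Fin n × Fin n × Fin n,
      ((A * p) l x.1 * (d * s * p) x.2.1 x.2.2) *
        starRingEnd ℂ ((A * p) m x.1 * (d * t * p) x.2.1 x.2.2 +
          (A * p) m x.2.2 * (d * t * p) x.2.1 x.1) := by
  have h1 : twistedCurvature a D A s t =
      ((d * t * p)ᴴ * (d * s * p)).trace • ((A * p) * (A * p)ᴴ) +
        (A * p) * ((d * t * p)ᴴ * (d * s * p)) * (A * p)ᴴ := by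
    have htr : (a⁻¹ * tᴴ * D * s).trace = ((d * t * p)ᴴ * (d * s * p)).trace := by
      rw [hp, hd, Matrix.mul_assoc, Matrix.mul_assoc, Matrix.mul_assoc, Matrix.trace_mul_comm]
      simp only [Matrix.conjTranspose_mul, Matrix.mul_assoc]
    rw [twistedCurvature, htr, Matrix.mul_add, Matrix.add_mul, hp, hd]
    simp only [Matrix.conjTranspose_mul, Matrix.mul_assoc, Matrix.mul_smul, Matrix.smul_mul]
  rw [h1]
  simp only [Fintype.sum_prod_type, map_add, mul_add, Finset.sum_add_distrib, Matrix.add_apply,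
    Matrix.smul_apply, smul_eq_mul, Matrix.trace, Matrix.diag_apply, Matrix.mul_apply (M := A * p),
    Matrix.mul_apply (M := (d * t * p)ᴴ), Matrix.conjTranspose_apply, map_mul,
    Matrix.mul_apply (M := A * p * ((d * t * p)ᴴ * (d * s * p)))]
  generalize A * p = B
  generalize d * s * p = S
  generalize d * t * p = T
  congr 1
  · rw [Finset.mul_sum]
    refine Finset.sum_congr rfl fun q _ => ?_
    rw [Finset.sum_comm, Finset.sum_mul]
    refine Finset.sum_congr rfl fun i _ => ?_
    rw [Finset.sum_mul]
    refine Finset.sum_congr rfl fun k _ => ?_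
    simp only [starRingEnd_apply]
    ring
  · simp only [Finset.sum_mul, Finset.mul_sum]
    rw [Finset.sum_comm]
    refine Finset.sum_congr rfl fun q _ => ?_
    rw [Finset.sum_comm]
    refine Finset.sum_congr rfl fun i _ => Finset.sum_congr rfl fun k _ => ?_
    simp only [starRingEnd_apply]
    ring

-- The positive square root serves as `d`; it is hermitian, and invertible because its square is.
open scoped ComplexOrder MatrixOrder in
theorem exists_isUnit_eq_conjTranspose_mul_self (hD : D.PosDef) :
    ∃ d : Matrix (Fin n) (Fin n) ℂ, IsUnit d ∧ D = dᴴ * d := by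
  have h1 : CFC.sqrt D * CFC.sqrt D = D := CFC.sqrt_mul_sqrt_self D hD.posSemidef.nonneg
  have h2 : (CFC.sqrt D)ᴴ = CFC.sqrt D := (Matrix.nonneg_iff_posSemidef.1 (CFC.sqrt_nonneg D)).isHermitian
  refine ⟨CFC.sqrt D, ?_, by rw [h2, h1]⟩
  have := hD.isUnit
  rw [← h1, Matrix.isUnit_iff_isUnit_det, Matrix.det_mul, IsUnit.mul_iff] at this
  exact (Matrix.isUnit_iff_isUnit_det _).2 this.1

-- The form is half a sum of squares, so only definiteness is at stake. If all squares vanish, the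
-- tensor built from `u` is antisymmetric in its outer indices; the symmetry of the `s j` makes it
-- symmetric in the last two, so it is zero. Independence of `s` and injectivity of `A` then give `u
-- = 0`.
open scoped ComplexOrder in
theorem twistedCurvature_pos (ha : a.PosDef) (hD : D.PosDef) {A : Matrix (Fin r) (Fin n) ℂ}
    (hA : Function.Injective fun y => y ᵥ* A) {N : ℕ} {s : Fin N → Matrix (Fin n) (Fin n) ℂ}
    (hs : ∀ j, (s j)ᵀ = s j) (hli : LinearIndependent ℂ s) {u : Fin N → Fin r → ℂ} (hu : u ≠ 0) :
    0 < (∑ j, ∑ k, ∑ l, ∑ m,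
      twistedCurvature a D A (s j) (s k) l m * u j l * starRingEnd ℂ (u k m)).re := by
  obtain ⟨p₀, hp₀u, hp₀⟩ := exists_isUnit_eq_conjTranspose_mul_self ha.inv
  obtain ⟨d, hdu, hd⟩ := exists_isUnit_eq_conjTranspose_mul_self hD
  set p := p₀ᴴ with hp
  have hpu : IsUnit p := hp₀u.star
  have hpp : a⁻¹ = p * pᴴ := by rw [hp, Matrix.conjTranspose_conjTranspose, hp₀]
  -- The involution exchanges the bundle index with the column index of the tangent matrix.
  let σ : Equiv.Perm (Fin n × Fin n × Fin n) :=
    { toFun := fun x => (x.2.2, x.2.1, x.1)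
      invFun := fun x => (x.2.2, x.2.1, x.1)
      left_inv := fun _ => rfl
      right_inv := fun _ => rfl }
  let Z : Fin N × Fin r → Fin n × Fin n × Fin n → ℂ := fun α x =>
    (A * p) α.2 x.1 * (d * s α.1 * p) x.2.1 x.2.2
  have h1 : ∑ j, ∑ k, ∑ l, ∑ m,
      twistedCurvature a D A (s j) (s k) l m * u j l * starRingEnd ℂ (u k m) =
      ∑ α : Fin N × Fin r, ∑ β : Fin N × Fin r, (∑ x, Z α x * starRingEnd ℂ (Z β x + Z β (σ x))) *
        u α.1 α.2 * starRingEnd ℂ (u β.1 β.2) := by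
    simp only [Fintype.sum_prod_type (f := fun α : Fin N × Fin r => ∑ β : Fin N × Fin r, _)]
    refine Finset.sum_congr rfl fun j _ => ?_
    rw [Finset.sum_comm]
    refine Finset.sum_congr rfl fun l _ => ?_
    rw [Fintype.sum_prod_type]
    refine Finset.sum_congr rfl fun k _ => Finset.sum_congr rfl fun m _ => ?_
    rw [twistedCurvature_apply p d A hpp hd]
    rfl
  rw [h1, re_sum_involution_form σ (fun _ => rfl) Z fun α => u α.1 α.2]
  refine div_pos (lt_of_le_of_ne (Finset.sum_nonneg fun _ _ => Complex.normSq_nonneg _)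
    fun h0 => hu ?_) two_pos
  have h2 : ∀ x, (∑ α : Fin N × Fin r, u α.1 α.2 * Z α x) +
      ∑ α : Fin N × Fin r, u α.1 α.2 * Z α (σ x) = 0 := fun x =>
    Complex.normSq_eq_zero.1 ((Finset.sum_eq_zero_iff_of_nonneg
      fun _ _ => Complex.normSq_nonneg _).1 h0.symm x (Finset.mem_univ x))
  -- Reading the bundle index of `u` through `A` and its tangent index through `s` gives the tensor
  -- `v y x z`, symmetric in `x`, `z`. The tensor `T` in the squares is `v` transformed by `p`, `d`,
  -- `p` in its three indices, and `M` is `v` rearranged so that the two indices to be exchanged are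
  -- those of a matrix.
  let w : Fin n → Fin N → ℂ := fun y j => (u j ᵥ* A) y
  let v : Fin n → Matrix (Fin n) (Fin n) ℂ := fun y => ∑ j, w y j • s j
  let M : Fin n → Matrix (Fin n) (Fin n) ℂ := fun x => Matrix.of fun y z => v y x z
  let T : Fin n → Matrix (Fin n) (Fin n) ℂ := fun q => ∑ y, p y q • (d * v y * p)
  have h3 : ∀ x, ∑ α : Fin N × Fin r, u α.1 α.2 * Z α x = T x.1 x.2.1 x.2.2 := by
    intro x
    have hT : T x.1 = ∑ j, ∑ l, (u j l * (A * p) l x.1) • (d * s j * p) := by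
      simp only [T, v, w, Matrix.mul_sum, Matrix.sum_mul, Matrix.mul_smul, Matrix.smul_mul,
        Finset.smul_sum, smul_smul]
      rw [Finset.sum_comm]
      refine Finset.sum_congr rfl fun j _ => ?_
      rw [← Finset.sum_smul, ← Finset.sum_smul]
      congr 1
      simp only [Matrix.vecMul, dotProduct, Matrix.mul_apply, Finset.mul_sum]
      rw [Finset.sum_comm]
      exact Finset.sum_congr rfl fun l _ => Finset.sum_congr rfl fun y _ => by ring
    rw [hT, Fintype.sum_prod_type]
    simp only [Matrix.sum_apply, Matrix.smul_apply, smul_eq_mul, Z]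
    exact Finset.sum_congr rfl fun j _ => Finset.sum_congr rfl fun l _ => by ring
  have h4 : ∀ q k i, T q i k + T k i q = 0 := fun q k i => by
    have := h2 (q, i, k)
    simp only [h3] at this
    exact this
  -- cancel the invertible matrices `d` and `p`
  have h5 : ∀ x, M x + (M x)ᵀ = 0 := by
    let R : Fin n → Matrix (Fin n) (Fin n) ℂ := fun x => pᵀ * M x * p
    have hR : ∀ q k x, (∑ y, p y q • (v y * p)) x k = R x q k := by
      intro q k x
      simp only [R, M, Matrix.mul_apply, Matrix.sum_apply, Matrix.smul_apply, smul_eq_mul,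
        Matrix.transpose_apply, Matrix.of_apply, Finset.mul_sum, Finset.sum_mul]
      rw [Finset.sum_comm]
      exact Finset.sum_congr rfl fun l _ => Finset.sum_congr rfl fun y _ => by ring
    have hTR : ∀ q k i, T q i k = ∑ x, d i x * R x q k := by
      intro q k i
      have : T q = d * ∑ y, p y q • (v y * p) := by
        simp only [T, Matrix.mul_sum, Matrix.mul_smul, Matrix.mul_assoc]
      rw [this, Matrix.mul_apply]
      simp only [hR]
    have hRR : ∀ q k x, R x q k + R x k q = 0 := by
      intro q k x
      have : d *ᵥ (fun x => R x q k + R x k q) = d *ᵥ 0 := by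
        ext i
        rw [Matrix.mulVec_zero, Pi.zero_apply, ← h4 q k i, hTR, hTR, ← Finset.sum_add_distrib]
        simp only [Matrix.mulVec, dotProduct, mul_add]
      exact congrFun (Matrix.mulVec_injective_of_isUnit hdu this) x
    intro x
    have h6 : pᵀ * (M x + (M x)ᵀ) * p = 0 := by
      have : pᵀ * (M x + (M x)ᵀ) * p = R x + (R x)ᵀ := by
        simp only [R, Matrix.mul_add, Matrix.add_mul, Matrix.transpose_mul,
          Matrix.transpose_transpose, Matrix.mul_assoc]
      rw [this]
      ext q k
      exact hRR q k x
    have hpt : IsUnit pᵀ := (Matrix.isUnit_transpose p).2 hpu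
    rw [hpu.mul_left_eq_zero, hpt.mul_right_eq_zero] at h6
    exact h6
  have hv : ∀ y, v y = 0 := by
    intro y
    ext x z
    refine eq_zero_of_symm_of_antisymm (X := v) (fun i j k => ?_) (fun i j k => ?_) y x z
    · have : (v i)ᵀ = v i := by simp only [v, Matrix.transpose_sum, Matrix.transpose_smul, hs]
      exact congrFun (congrFun this k) j
    · exact eq_neg_of_add_eq_zero_left (congrFun (congrFun (h5 j) i) k)
  ext j l
  have hw : ∀ y, w y j = 0 := fun y => Fintype.linearIndependent_iff.1 hli (w y) (hv y) j
  exact congrFun (hA (a₁ := u j) (a₂ := 0) (by ext y; simpa using hw y)) l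

end NakanoAlgebra

/-! ### Wirtinger calculus for matrix-valued functions, entry by entry. -/

section MatrixCalculus

/-- The entries of the matrix-valued function `M` are `C^m` at `z`. -/
def EntriesContDiffAt (𝕜 : Type*) {E ι κ : Type*} [NontriviallyNormedField 𝕜] [NormedAlgebra 𝕜 ℂ]
    [NormedAddCommGroup E] [NormedSpace 𝕜 E] (m : WithTop ℕ∞) (M : E → Matrix ι κ ℂ) (z : E) :
    Prop :=
  ∀ i j, ContDiffAt 𝕜 m (fun y => M y i j) z

namespace EntriesContDiffAt

section Field

variable {𝕜 E : Type*} [NontriviallyNormedField 𝕜] [NormedAlgebra 𝕜 ℂ] [NormedAddCommGroup E]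
  [NormedSpace 𝕜 E] {m : WithTop ℕ∞} {z : E} {ι κ μ : Type*}

theorem const (A : Matrix ι κ ℂ) : EntriesContDiffAt 𝕜 m (fun _ : E => A) z :=
  fun _ _ => contDiffAt_const

theorem add {A B : E → Matrix ι κ ℂ} (hA : EntriesContDiffAt 𝕜 m A z)
    (hB : EntriesContDiffAt 𝕜 m B z) : EntriesContDiffAt 𝕜 m (fun y => A y + B y) z :=
  fun i j => (hA i j).add (hB i j)

theorem smul {f : E → ℂ} {B : E → Matrix ι κ ℂ} (hf : ContDiffAt 𝕜 m f z)
    (hB : EntriesContDiffAt 𝕜 m B z) : EntriesContDiffAt 𝕜 m (fun y => f y • B y) z :=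
  fun i j => hf.mul (hB i j)

theorem mul [Fintype κ] {A : E → Matrix ι κ ℂ} {B : E → Matrix κ μ ℂ}
    (hA : EntriesContDiffAt 𝕜 m A z) (hB : EntriesContDiffAt 𝕜 m B z) :
    EntriesContDiffAt 𝕜 m (fun y => A y * B y) z := by
  intro i j
  simp only [Matrix.mul_apply]
  exact ContDiffAt.sum fun k _ => (hA i k).mul (hB k j)

theorem congr {A B : E → Matrix ι κ ℂ} (hA : EntriesContDiffAt 𝕜 m A z)
    (h : B =ᶠ[nhds z] A) : EntriesContDiffAt 𝕜 m B z :=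
  fun i j => (hA i j).congr_of_eventuallyEq (h.mono fun y hy => by simp only [hy])

theorem trace [Fintype κ] {A : E → Matrix κ κ ℂ} (hA : EntriesContDiffAt 𝕜 m A z) :
    ContDiffAt 𝕜 m (fun y => (A y).trace) z :=
  ContDiffAt.sum fun k _ => hA k k

theorem det [Fintype κ] [DecidableEq κ] {A : E → Matrix κ κ ℂ}
    (hA : EntriesContDiffAt 𝕜 m A z) : ContDiffAt 𝕜 m (fun y => (A y).det) z := by
  simp only [Matrix.det_apply']
  exact ContDiffAt.sum fun τ _ => contDiffAt_const.mul (contDiffAt_prod fun i _ => hA _ _)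

theorem inv [Fintype κ] [DecidableEq κ] {A : E → Matrix κ κ ℂ}
    (hA : EntriesContDiffAt 𝕜 m A z) (h : (A z).det ≠ 0) :
    EntriesContDiffAt 𝕜 m (fun y => (A y)⁻¹) z := by
  simp only [Matrix.inv_def, Ring.inverse_eq_inv']
  refine smul (hA.det.inv h) fun i j => ?_
  simp only [Matrix.adjugate_apply]
  refine det fun k l => ?_
  simp only [Matrix.updateRow_apply]
  split_ifs
  · exact contDiffAt_const
  · exact hA k l

theorem eventually_det_ne_zero [Fintype κ] [DecidableEq κ] {A : E → Matrix κ κ ℂ}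
    (hA : EntriesContDiffAt 𝕜 m A z) (h : (A z).det ≠ 0) : ∀ᶠ y in nhds z, (A y).det ≠ 0 :=
  hA.det.continuousAt.eventually_ne h

/-- The value `∞` is excluded because `ContDiffAt` at order `∞` allows neighbourhoods that shrink
with the finite order. The analytic case `ω` does spread to a neighbourhood. -/
theorem eventually [Finite ι] [Finite κ] {A : E → Matrix ι κ ℂ} (hA : EntriesContDiffAt 𝕜 m A z)
    (hm : m ≠ ∞) : ∀ᶠ y in nhds z, EntriesContDiffAt 𝕜 m A y :=
  Filter.eventually_all.2 fun i => Filter.eventually_all.2 fun j => (hA i j).eventually hm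

theorem differentiableAt {A : E → Matrix ι κ ℂ} (hA : EntriesContDiffAt 𝕜 m A z) (hm : m ≠ 0)
    (i : ι) (j : κ) : DifferentiableAt 𝕜 (fun y => A y i j) z :=
  (hA i j).differentiableAt hm

end Field

variable {E : Type*} [NormedAddCommGroup E] [NormedSpace ℂ E] {z : E} {ι κ : Type*}
  {A : E → Matrix ι κ ℂ}

theorem restrictScalars (hA : EntriesContDiffAt ℂ ω A z) : EntriesContDiffAt ℝ ∞ A z :=
  fun i j => ((hA i j).restrict_scalars ℝ).of_le le_top

theorem conjTranspose (hA : EntriesContDiffAt ℝ ∞ A z) :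
    EntriesContDiffAt ℝ ∞ (fun y => (A y)ᴴ) z :=
  fun i j => Complex.conjCLE.contDiff.contDiffAt.comp z (hA j i)

end EntriesContDiffAt

/-- The operator `(∂_v + c ∂_{iv}) / 2`: this is `∂` for `c = -i` and `∂̄` for `c = i`. -/
noncomputable def wirtinger {E : Type*} [NormedAddCommGroup E] [NormedSpace ℂ E] (c : ℂ)
    (f : E → ℂ) (v : E) (z : E) : ℂ :=
  (fderiv ℝ f z v + c * fderiv ℝ f z (Complex.I • v)) / 2

variable {E : Type*} [NormedAddCommGroup E] [NormedSpace ℂ E] {c : ℂ} {f g : E → ℂ} {v z : E}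

theorem dHol_eq_wirtinger (f : E → ℂ) (v z : E) : dHol f v z = wirtinger (-Complex.I) f v z := by
  rw [dHol, wirtinger, neg_mul, sub_eq_add_neg]

theorem wirtinger_const (a : ℂ) : wirtinger c (fun _ => a) v z = 0 := by
  simp [wirtinger]

theorem wirtinger_congr (h : f =ᶠ[nhds z] g) : wirtinger c f v z = wirtinger c g v z := by
  rw [wirtinger, wirtinger, h.fderiv_eq]

theorem wirtinger_add (hf : DifferentiableAt ℝ f z) (hg : DifferentiableAt ℝ g z) :
    wirtinger c (fun y => f y + g y) v z = wirtinger c f v z + wirtinger c g v z := by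
  simp only [wirtinger, fderiv_fun_add hf hg, _root_.add_apply]
  ring

theorem wirtinger_neg : wirtinger c (fun y => -f y) v z = -wirtinger c f v z := by
  simp only [wirtinger, fderiv_fun_neg, _root_.neg_apply]
  ring

theorem wirtinger_mul (hf : DifferentiableAt ℝ f z) (hg : DifferentiableAt ℝ g z) :
    wirtinger c (fun y => f y * g y) v z =
      wirtinger c f v z * g z + f z * wirtinger c g v z := by
  simp only [wirtinger, fderiv_fun_mul hf hg, _root_.add_apply,
    _root_.smul_apply, smul_eq_mul]
  ring

theorem wirtinger_sum {ι : Type*} (s : Finset ι) {f : ι → E → ℂ}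
    (hf : ∀ i ∈ s, DifferentiableAt ℝ (f i) z) :
    wirtinger c (fun y => ∑ i ∈ s, f i y) v z = ∑ i ∈ s, wirtinger c (f i) v z := by
  simp only [wirtinger, fderiv_fun_sum hf, _root_.sum_apply, Finset.mul_sum,
    ← Finset.sum_add_distrib, Finset.sum_div]

theorem wirtinger_prod {ι : Type*} [DecidableEq ι] (s : Finset ι) {f : ι → E → ℂ}
    (hf : ∀ i ∈ s, DifferentiableAt ℝ (f i) z) :
    wirtinger c (fun y => ∏ i ∈ s, f i y) v z =
      ∑ i ∈ s, (∏ j ∈ s.erase i, f j z) * wirtinger c (f i) v z := by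
  simp only [wirtinger, fderiv_finsetProd hf, _root_.sum_apply,
    _root_.smul_apply, smul_eq_mul, Finset.mul_sum, ← Finset.sum_add_distrib,
    Finset.sum_div]
  exact Finset.sum_congr rfl fun i _ => by ring

/-- The Leibniz rule is applied to `f · f⁻¹`, which is constant near `z` because `f` stays nonzero
there. -/
theorem wirtinger_inv (hf : DifferentiableAt ℝ f z) (h : f z ≠ 0) :
    wirtinger c (fun y => (f y)⁻¹) v z = -(f z)⁻¹ * ((f z)⁻¹ * wirtinger c f v z) := by
  have h1 : wirtinger c (fun y => f y * (f y)⁻¹) v z = 0 := by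
    rw [← wirtinger_const (c := c) (v := v) (z := z) 1]
    refine wirtinger_congr ?_
    filter_upwards [hf.continuousAt.eventually_ne h] with y hy
    exact mul_inv_cancel₀ hy
  rw [wirtinger_mul hf (hf.fun_inv h)] at h1
  field_simp
  field_simp at h1
  linear_combination h1

theorem wirtinger_conj : wirtinger c (fun y => starRingEnd ℂ (f y)) v z =
    starRingEnd ℂ (wirtinger (starRingEnd ℂ c) f v z) := by
  have : fderiv ℝ (fun y => starRingEnd ℂ (f y)) z =
      (Complex.conjCLE : ℂ →L[ℝ] ℂ).comp (fderiv ℝ f z) :=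
    Complex.conjCLE.comp_fderiv
  simp only [wirtinger, this, map_div₀, map_add, map_mul, Complex.conj_conj, map_ofNat]
  rfl

theorem wirtinger_I_of_differentiableAt (hf : DifferentiableAt ℂ f z) :
    wirtinger Complex.I f v z = 0 := by
  rw [wirtinger, hf.fderiv_restrictScalars ℝ]
  simp only [ContinuousLinearMap.coe_restrictScalars', map_smul, smul_eq_mul, ← mul_assoc,
    Complex.I_mul_I]
  ring

theorem wirtinger_neg_I_of_differentiableAt (hf : DifferentiableAt ℂ f z) :
    wirtinger (-Complex.I) f v z = fderiv ℂ f z v := by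
  rw [wirtinger, hf.fderiv_restrictScalars ℝ]
  simp only [ContinuousLinearMap.coe_restrictScalars', map_smul, smul_eq_mul, neg_mul, ← mul_assoc,
    Complex.I_mul_I]
  ring

/-- The operator `wirtinger` applied to each entry. -/
noncomputable def wirtingerMat {ι κ : Type*} (c : ℂ) (M : E → Matrix ι κ ℂ) (v z : E) :
    Matrix ι κ ℂ :=
  Matrix.of fun i j => wirtinger c (fun y => M y i j) v z

variable {ι κ μ : Type*}

theorem wirtingerMat_congr {A B : E → Matrix ι κ ℂ} (h : A =ᶠ[nhds z] B) :
    wirtingerMat c A v z = wirtingerMat c B v z := by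
  ext i j
  exact wirtinger_congr (h.mono fun y hy => by simp only [hy])

theorem wirtingerMat_const (A : Matrix ι κ ℂ) : wirtingerMat c (fun _ => A) v z = 0 := by
  ext i j
  exact wirtinger_const _

theorem wirtingerMat_add {A B : E → Matrix ι κ ℂ} (hA : EntriesContDiffAt ℝ ∞ A z)
    (hB : EntriesContDiffAt ℝ ∞ B z) :
    wirtingerMat c (fun y => A y + B y) v z = wirtingerMat c A v z + wirtingerMat c B v z := by
  ext i j
  exact wirtinger_add (hA.differentiableAt (by simp) i j) (hB.differentiableAt (by simp) i j)

theorem wirtingerMat_neg {A : E → Matrix ι κ ℂ} :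
    wirtingerMat c (fun y => -A y) v z = -wirtingerMat c A v z := by
  ext i j
  exact wirtinger_neg

theorem wirtingerMat_smul {f : E → ℂ} {B : E → Matrix ι κ ℂ} (hf : ContDiffAt ℝ ∞ f z)
    (hB : EntriesContDiffAt ℝ ∞ B z) :
    wirtingerMat c (fun y => f y • B y) v z =
      wirtinger c f v z • B z + f z • wirtingerMat c B v z := by
  ext i j
  exact wirtinger_mul (hf.differentiableAt (by simp)) (hB.differentiableAt (by simp) i j)

theorem wirtingerMat_mul [Fintype κ] {A : E → Matrix ι κ ℂ} {B : E → Matrix κ μ ℂ}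
    (hA : EntriesContDiffAt ℝ ∞ A z) (hB : EntriesContDiffAt ℝ ∞ B z) :
    wirtingerMat c (fun y => A y * B y) v z =
      wirtingerMat c A v z * B z + A z * wirtingerMat c B v z := by
  ext i j
  have h1 := fun k => hA.differentiableAt (by simp) i k
  have h2 := fun k => hB.differentiableAt (by simp) k j
  change wirtinger c (fun y => (A y * B y) i j) v z = _
  simp only [Matrix.mul_apply, Matrix.add_apply]
  rw [wirtinger_sum _ fun k _ => (h1 k).fun_mul (h2 k), ← Finset.sum_add_distrib]
  exact Finset.sum_congr rfl fun k _ => wirtinger_mul (h1 k) (h2 k)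

theorem wirtingerMat_conjTranspose {A : E → Matrix ι κ ℂ} :
    wirtingerMat c (fun y => (A y)ᴴ) v z = (wirtingerMat (starRingEnd ℂ c) A v z)ᴴ := by
  ext i j
  exact wirtinger_conj

theorem wirtingerMat_I {A : E → Matrix ι κ ℂ} (hA : EntriesContDiffAt ℂ ω A z) :
    wirtingerMat Complex.I A v z = 0 := by
  ext i j
  exact wirtinger_I_of_differentiableAt (hA.differentiableAt (by simp) i j)

theorem wirtinger_trace [Fintype κ] {A : E → Matrix κ κ ℂ} (hA : EntriesContDiffAt ℝ ∞ A z) :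
    wirtinger c (fun y => (A y).trace) v z = (wirtingerMat c A v z).trace :=
  wirtinger_sum _ fun k _ => hA.differentiableAt (by simp) k k

variable [Fintype κ] [DecidableEq κ] {K : E → Matrix κ κ ℂ}

/-- Jacobi's formula. -/
theorem wirtinger_det (hK : EntriesContDiffAt ℝ ∞ K z) :
    wirtinger c (fun y => (K y).det) v z =
      ((K z).adjugate * wirtingerMat c K v z).trace := by
  have h1 := fun i j => hK.differentiableAt (by simp) i j
  have h2 : ∀ k, ((K z).adjugate * wirtingerMat c K v z) k k = ∑ τ : Equiv.Perm κ,
      ((Equiv.Perm.sign τ : ℤ) : ℂ) *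
        ((∏ j ∈ Finset.univ.erase k, K z (τ j) j) * wirtingerMat c K v z (τ k) k) := by
    intro k
    -- By Cramer's rule a diagonal entry is the determinant of `K z` with its `k`-th column
    -- differentiated; the trace is thus the Leibniz rule over columns.
    have : ((K z).adjugate * wirtingerMat c K v z) k k =
        ((K z).updateCol k fun i => wirtingerMat c K v z i k).det := by
      rw [← Matrix.cramer_apply, Matrix.cramer_eq_adjugate_mulVec]
      rfl
    rw [this, Matrix.det_apply']
    refine Finset.sum_congr rfl fun τ _ => ?_
    rw [← Finset.prod_erase_mul _ _ (Finset.mem_univ k), Matrix.updateCol_self]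
    congr 2
    refine Finset.prod_congr rfl fun j hj => ?_
    rw [Matrix.updateCol_ne (Finset.ne_of_mem_erase hj)]
  have h3 : ∀ τ : Equiv.Perm κ, DifferentiableAt ℝ (fun y => ∏ i, K y (τ i) i) z := fun τ =>
    (contDiffAt_prod fun i _ => hK (τ i) i).differentiableAt (by simp)
  simp only [Matrix.det_apply', Matrix.trace, Matrix.diag_apply, h2]
  rw [wirtinger_sum _ fun τ _ => (h3 τ).const_mul _,
    Finset.sum_comm]
  refine Finset.sum_congr rfl fun τ _ => ?_
  rw [wirtinger_mul (differentiableAt_const _) (h3 τ),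
    wirtinger_const, zero_mul, zero_add, wirtinger_prod _ fun i _ => h1 _ _, Finset.mul_sum]
  rfl

/-- The same argument as for scalars, with the order of the factors kept: differentiate `K K⁻¹ = 1`
and multiply by `K⁻¹` on the left. -/
theorem wirtingerMat_inv (hK : EntriesContDiffAt ℝ ∞ K z) (h : (K z).det ≠ 0) :
    wirtingerMat c (fun y => (K y)⁻¹) v z =
      -((K z)⁻¹ * wirtingerMat c K v z * (K z)⁻¹) := by
  have hu : IsUnit (K z).det := isUnit_iff_ne_zero.2 h
  have h1 : wirtingerMat c (fun y => K y * (K y)⁻¹) v z = 0 := by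
    rw [← wirtingerMat_const (c := c) (v := v) (z := z) 1]
    refine wirtingerMat_congr ?_
    filter_upwards [hK.eventually_det_ne_zero h] with y hy
    exact Matrix.mul_nonsing_inv _ (isUnit_iff_ne_zero.2 hy)
  rw [wirtingerMat_mul hK (hK.inv h)] at h1
  have h2 := congrArg ((K z)⁻¹ * ·) h1
  simp only [Matrix.mul_add, Matrix.mul_zero, ← Matrix.mul_assoc, Matrix.nonsing_inv_mul _ hu,
    Matrix.one_mul] at h2
  exact eq_neg_of_add_eq_zero_right h2

theorem wirtinger_inv_det (hK : EntriesContDiffAt ℝ ∞ K z) (h : (K z).det ≠ 0) :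
    wirtinger c (fun y => (K y).det⁻¹) v z =
      -(K z).det⁻¹ * ((K z)⁻¹ * wirtingerMat c K v z).trace := by
  rw [wirtinger_inv (hK.det.differentiableAt (by simp)) h, wirtinger_det hK, Matrix.inv_def,
    Ring.inverse_eq_inv', Matrix.smul_mul, Matrix.trace_smul, smul_eq_mul]

end MatrixCalculus

/-! ### Chern connection and curvature of the metric `(det K)⁻¹ A K⁻¹ Aᴴ`. -/

section ChernCurvature

variable {E : Type*} [NormedAddCommGroup E] [NormedSpace ℂ E] {v w z : E} {n : ℕ}
  {H K A S : E → Matrix (Fin n) (Fin n) ℂ}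

theorem chernForm_eq_wirtingerMat (H : E → Matrix (Fin n) (Fin n) ℂ) (v z : E) :
    chernForm H v z = wirtingerMat (-Complex.I) H v z * (H z)⁻¹ := by
  simp only [chernForm, wirtingerMat, dHol_eq_wirtinger]

theorem chernCurvature_eq_wirtingerMat (H : E → Matrix (Fin n) (Fin n) ℂ) (v w z : E) :
    chernCurvature H v w z = -wirtingerMat Complex.I (chernForm H v) w z := rfl

theorem chernForm_congr {H' : E → Matrix (Fin n) (Fin n) ℂ} (h : H =ᶠ[nhds z] H') :
    chernForm H v z = chernForm H' v z := by
  rw [chernForm_eq_wirtingerMat, chernForm_eq_wirtingerMat, wirtingerMat_congr h, h.eq_of_nhds]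

/-- The Chern connection of `(det K)⁻¹ A K⁻¹ Aᴴ`, for `A` holomorphic. -/
theorem chernForm_inv_det_smul (hK : EntriesContDiffAt ℝ ∞ K z) (hA : EntriesContDiffAt ℂ ω A z)
    (hKz : (K z).det ≠ 0) (hAz : (A z).det ≠ 0) :
    chernForm (fun y => (K y).det⁻¹ • (A y * (K y)⁻¹ * (A y)ᴴ)) v z =
      wirtingerMat (-Complex.I) A v z * (A z)⁻¹ +
        -(((K z)⁻¹ * wirtingerMat (-Complex.I) K v z).trace • (1 : Matrix (Fin n) (Fin n) ℂ) +
          A z * ((K z)⁻¹ * wirtingerMat (-Complex.I) K v z) * (A z)⁻¹) := by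
  have hAr := hA.restrictScalars
  have hAu : IsUnit (A z).det := isUnit_iff_ne_zero.2 hAz
  have hKi := hK.inv hKz
  have hdet : ContDiffAt ℝ ∞ (fun y => (K y).det⁻¹) z := hK.det.inv hKz
  -- `∂(Aᴴ) = (∂̄A)ᴴ`, which vanishes since `A` is holomorphic.
  have hAs : wirtingerMat (-Complex.I) (fun y => (A y)ᴴ) v z = 0 := by
    rw [wirtingerMat_conjTranspose, map_neg, Complex.conj_I, neg_neg, wirtingerMat_I hA,
      Matrix.conjTranspose_zero]
  have hHu : IsUnit ((K z).det⁻¹ • (A z * (K z)⁻¹ * (A z)ᴴ)).det := by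
    have h1 : (A z)ᴴ.det ≠ 0 := by rwa [Matrix.det_conjTranspose, star_ne_zero]
    have h2 : (K z)⁻¹.det ≠ 0 := by
      rw [Matrix.det_nonsing_inv, Ring.inverse_eq_inv']
      exact inv_ne_zero hKz
    rw [Matrix.det_smul, Matrix.det_mul, Matrix.det_mul, isUnit_iff_ne_zero]
    exact mul_ne_zero (pow_ne_zero _ (inv_ne_zero hKz)) (mul_ne_zero (mul_ne_zero hAz h2) h1)
  rw [chernForm_eq_wirtingerMat, wirtingerMat_smul hdet
    ((hAr.mul hKi).mul hAr.conjTranspose), wirtingerMat_mul (hAr.mul hKi) hAr.conjTranspose,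
    wirtingerMat_mul hAr hKi, hAs, wirtingerMat_inv hK hKz, wirtinger_inv_det hK hKz]
  set X := (K z)⁻¹ * wirtingerMat (-Complex.I) K v z
  set f := (K z).det⁻¹
  generalize hB : wirtingerMat (-Complex.I) A v z = B
  -- The derivative of the metric is displayed as the asserted connection form times the metric, so
  -- that the inverse of the metric cancels.
  have key : (-f * X.trace) • (A z * (K z)⁻¹ * (A z)ᴴ) +
      f • ((B * (K z)⁻¹ + A z * -(X * (K z)⁻¹)) * (A z)ᴴ + A z * (K z)⁻¹ * 0) =
      (B * (A z)⁻¹ + -(X.trace • (1 : Matrix (Fin n) (Fin n) ℂ) + A z * X * (A z)⁻¹)) *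
        (f • (A z * (K z)⁻¹ * (A z)ᴴ)) := by
    have h1 : B * (A z)⁻¹ * (A z * (K z)⁻¹ * (A z)ᴴ) = B * (K z)⁻¹ * (A z)ᴴ := by
      simp only [← Matrix.mul_assoc, Matrix.nonsing_inv_mul_cancel_right _ _ hAu]
    have h2 : A z * X * (A z)⁻¹ * (A z * (K z)⁻¹ * (A z)ᴴ) = A z * (X * (K z)⁻¹) * (A z)ᴴ := by
      simp only [← Matrix.mul_assoc, Matrix.nonsing_inv_mul_cancel_right _ _ hAu]
    simp only [Matrix.mul_smul, Matrix.add_mul, Matrix.smul_mul, Matrix.one_mul,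
      Matrix.mul_zero, Matrix.mul_neg, h1, h2, neg_mul, neg_smul, mul_smul, smul_add, smul_neg,
      neg_add, add_zero]
    abel
  rw [key, Matrix.mul_nonsing_inv_cancel_right _ _ hHu]

/-- The matrix of complex derivatives in direction `v` of the entries of `S`. -/
noncomputable def entryDeriv (S : E → Matrix (Fin n) (Fin n) ℂ) (v z : E) :
    Matrix (Fin n) (Fin n) ℂ :=
  Matrix.of fun i j => fderiv ℂ (fun y => S y i j) z v

theorem wirtingerMat_neg_I (hS : EntriesContDiffAt ℂ ω S z) :
    wirtingerMat (-Complex.I) S v z = entryDeriv S v z := by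
  ext i j
  exact wirtinger_neg_I_of_differentiableAt (hS.differentiableAt (by simp) i j)

theorem EntriesContDiffAt.entryDeriv (hS : EntriesContDiffAt ℂ ω S z) :
    EntriesContDiffAt ℂ ω (entryDeriv S v) z := fun i j =>
  ((hS i j).fderiv_right (m := ω) (by simp)).clm_apply contDiffAt_const

variable {a b d : Matrix (Fin n) (Fin n) ℂ}

/-- The Gram matrix of the columns of `(1, S)` for the hermitian matrix with blocks `a`, `b`, `bᴴ`,
`d`. -/
def graphGram (a b d S : Matrix (Fin n) (Fin n) ℂ) : Matrix (Fin n) (Fin n) ℂ :=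
  a + b * S + Sᴴ * (bᴴ + d * S)

theorem EntriesContDiffAt.graphGram (hS : EntriesContDiffAt ℝ ∞ S z) :
    EntriesContDiffAt ℝ ∞ (fun y => graphGram a b d (S y)) z :=
  ((const a).add ((const b).mul hS)).add
    (hS.conjTranspose.mul ((const bᴴ).add ((const d).mul hS)))

/-- For `∂` the factor `Sᴴ` behaves as a constant, so only the occurrences of `S` itself contribute.
-/
theorem wirtingerMat_neg_I_graphGram (hS : EntriesContDiffAt ℂ ω S z) :
    wirtingerMat (-Complex.I) (fun y => graphGram a b d (S y)) v z =
      (b + (S z)ᴴ * d) * entryDeriv S v z := by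
  have hr := hS.restrictScalars
  have hc := fun A : Matrix (Fin n) (Fin n) ℂ => EntriesContDiffAt.const (𝕜 := ℝ) (m := ∞) (z := z) A
  have h1 : wirtingerMat (-Complex.I) (fun y => (S y)ᴴ) v z = 0 := by
    rw [wirtingerMat_conjTranspose, map_neg, Complex.conj_I, neg_neg, wirtingerMat_I hS,
      Matrix.conjTranspose_zero]
  simp only [graphGram]
  rw [wirtingerMat_add ((hc a).add ((hc b).mul hr))
    (hr.conjTranspose.mul ((hc bᴴ).add ((hc d).mul hr))), wirtingerMat_add (hc a) ((hc b).mul hr),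
    wirtingerMat_mul (hc b) hr, wirtingerMat_mul hr.conjTranspose ((hc bᴴ).add ((hc d).mul hr)),
    wirtingerMat_add (hc bᴴ) ((hc d).mul hr), wirtingerMat_mul (hc d) hr, h1]
  simp only [wirtingerMat_const, wirtingerMat_neg_I hS, Matrix.zero_mul, zero_add, Matrix.add_mul,
    Matrix.mul_assoc]

theorem wirtingerMat_I_graphGram (hS : EntriesContDiffAt ℂ ω S z) :
    wirtingerMat Complex.I (fun y => graphGram a b d (S y)) v z =
      (entryDeriv S v z)ᴴ * (bᴴ + d * S z) := by
  have hr := hS.restrictScalars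
  have hc := fun A : Matrix (Fin n) (Fin n) ℂ => EntriesContDiffAt.const (𝕜 := ℝ) (m := ∞) (z := z) A
  have h1 : wirtingerMat Complex.I (fun y => (S y)ᴴ) v z = (entryDeriv S v z)ᴴ := by
    rw [wirtingerMat_conjTranspose, Complex.conj_I, wirtingerMat_neg_I hS]
  simp only [graphGram]
  rw [wirtingerMat_add ((hc a).add ((hc b).mul hr))
    (hr.conjTranspose.mul ((hc bᴴ).add ((hc d).mul hr))), wirtingerMat_add (hc a) ((hc b).mul hr),
    wirtingerMat_mul (hc b) hr, wirtingerMat_mul hr.conjTranspose ((hc bᴴ).add ((hc d).mul hr)),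
    wirtingerMat_add (hc bᴴ) ((hc d).mul hr), wirtingerMat_mul (hc d) hr, h1, wirtingerMat_I hS]
  simp only [wirtingerMat_const, Matrix.zero_mul, zero_add, Matrix.mul_zero, add_zero]

/-- The curvature of `(det K)⁻¹ A K⁻¹ Aᴴ` at a zero of `S`, where `A` and `S` are holomorphic and
`K = graphGram a b d S`. -/
theorem chernCurvature_mul_of_graphGram (ha : a.det ≠ 0) (hS : EntriesContDiffAt ℂ ω S z)
    (hA : EntriesContDiffAt ℂ ω A z) (hSz : S z = 0) (hAz : (A z).det ≠ 0)
    (hH : H =ᶠ[nhds z] fun y => (graphGram a b d (S y)).det⁻¹ •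
      (A y * (graphGram a b d (S y))⁻¹ * (A y)ᴴ)) :
    chernCurvature H v w z * H z = a.det⁻¹ • twistedCurvature a (d - bᴴ * a⁻¹ * b) (A z)
      (entryDeriv S v z) (entryDeriv S w z) := by
  have hKz : graphGram a b d (S z) = a := by simp [graphGram, hSz]
  have hKdet : (graphGram a b d (S z)).det ≠ 0 := by rwa [hKz]
  have hr := hS.restrictScalars
  have hK : EntriesContDiffAt ℝ ∞ (fun y => graphGram a b d (S y)) z := hr.graphGram
  have hKi := hK.inv hKdet
  have hDr : EntriesContDiffAt ℝ ∞ (entryDeriv S v) z := hS.entryDeriv.restrictScalars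
  have hc := fun A : Matrix (Fin n) (Fin n) ℂ => EntriesContDiffAt.const (𝕜 := ℝ) (m := ∞) (z := z) A
  have hAi := hA.inv hAz
  let X : E → Matrix (Fin n) (Fin n) ℂ := fun y =>
    (graphGram a b d (S y))⁻¹ * ((b + (S y)ᴴ * d) * entryDeriv S v y)
  have hB := (hc b).add (hr.conjTranspose.mul (hc d))
  have hX : EntriesContDiffAt ℝ ∞ X z := hKi.mul (hB.mul hDr)
  -- The connection form is still to be differentiated, so it must be known on a neighbourhood, not
  -- only at the zero of `S`.
  have hθ : chernForm H v =ᶠ[nhds z] fun y => entryDeriv A v y * (A y)⁻¹ +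
      -((X y).trace • (1 : Matrix (Fin n) (Fin n) ℂ) + A y * X y * (A y)⁻¹) := by
    filter_upwards [hH.eventually_nhds, hS.eventually (by simp), hA.eventually (by simp),
      hK.eventually_det_ne_zero hKdet, hA.eventually_det_ne_zero hAz] with y h1 h2 h3 h4 h5
    rw [chernForm_congr h1, chernForm_inv_det_smul h2.restrictScalars.graphGram h3 h4 h5,
      wirtingerMat_neg_I h3, wirtingerMat_neg_I_graphGram h2]
  -- At `S = 0`, differentiating `K⁻¹` contributes `-a⁻¹ tᴴ bᴴ a⁻¹ b s` and differentiating `Sᴴ d`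
  -- contributes `a⁻¹ tᴴ d s`; their sum contains the Schur complement.
  have hXbar : wirtingerMat Complex.I X w z =
      a⁻¹ * (entryDeriv S w z)ᴴ * (d - bᴴ * a⁻¹ * b) * entryDeriv S v z := by
    have h1 : wirtingerMat Complex.I (fun y => (S y)ᴴ) w z = (entryDeriv S w z)ᴴ := by
      rw [wirtingerMat_conjTranspose, Complex.conj_I, wirtingerMat_neg_I hS]
    simp only [X]
    rw [wirtingerMat_mul hKi (hB.mul hDr), wirtingerMat_mul hB hDr, wirtingerMat_inv hK hKdet,
      wirtingerMat_I_graphGram hS, wirtingerMat_add (hc b) (hr.conjTranspose.mul (hc d)),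
      wirtingerMat_mul hr.conjTranspose (hc d), h1, wirtingerMat_I hS.entryDeriv]
    rw [hKz]
    simp only [wirtingerMat_const, hSz, Matrix.conjTranspose_zero, Matrix.mul_zero,
      Matrix.zero_mul, add_zero, zero_add, Matrix.mul_sub, Matrix.sub_mul, Matrix.neg_mul,
      Matrix.mul_assoc]
    abel
  have hAr := hA.restrictScalars
  have hAir := hAi.restrictScalars
  -- `∂A · A⁻¹` is holomorphic: the choice of holomorphic frame adds nothing to the curvature beyond
  -- conjugation by `A`.
  have h1 : wirtingerMat Complex.I (fun y => entryDeriv A v y * (A y)⁻¹) w z = 0 :=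
    wirtingerMat_I (hA.entryDeriv.mul hAi)
  have htr : EntriesContDiffAt ℝ ∞ (fun y => (X y).trace • (1 : Matrix (Fin n) (Fin n) ℂ)) z :=
    EntriesContDiffAt.smul hX.trace (hc 1)
  have hAX : EntriesContDiffAt ℝ ∞ (fun y => A y * X y * (A y)⁻¹) z := (hAr.mul hX).mul hAir
  have hneg : EntriesContDiffAt ℝ ∞ (fun y => -((X y).trace • (1 : Matrix (Fin n) (Fin n) ℂ) +
      A y * X y * (A y)⁻¹)) z := fun i j => ((htr.add hAX) i j).neg
  rw [chernCurvature_eq_wirtingerMat, wirtingerMat_congr hθ,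
    wirtingerMat_add (hA.entryDeriv.mul hAi).restrictScalars hneg, h1, zero_add, wirtingerMat_neg,
    neg_neg, wirtingerMat_add htr hAX, wirtingerMat_smul hX.trace (hc 1), wirtingerMat_const,
    smul_zero, add_zero, wirtingerMat_mul (hAr.mul hX) hAir, wirtingerMat_mul hAr hX,
    wirtingerMat_I hA, wirtingerMat_I hAi, wirtinger_trace hX, hXbar, hH.eq_of_nhds, hKz]
  have hAu : IsUnit (A z).det := isUnit_iff_ne_zero.2 hAz
  simp only [twistedCurvature, Matrix.mul_smul, Matrix.zero_mul, zero_add, Matrix.mul_zero,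
    add_zero, Matrix.add_mul, Matrix.smul_mul, Matrix.one_mul, Matrix.mul_add]
  simp only [Matrix.mul_assoc, Matrix.nonsing_inv_mul_cancel_left _ _ hAu]

end ChernCurvature

/-! ### The metric of `Q(1)` in a symplectic frame, through Riesz duality. -/

/-- The Gram matrices of two bases that are dual to each other are inverse to each other. -/
theorem gram_mul_gram_eq_one {W : Type*} [NormedAddCommGroup W] [InnerProductSpace ℂ W] {n : ℕ}
    (b : OrthonormalBasis (Fin n) ℂ W) {r q : Fin n → W}
    (h : ∀ i j, inner ℂ (r i) (q j) = if i = j then 1 else 0) :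
    Matrix.gram ℂ q * Matrix.gram ℂ r = 1 := by
  -- Coordinates in an orthonormal basis turn each family into a square matrix, so duality, a
  -- one-sided inverse relation, becomes two-sided.
  let M : (Fin n → W) → Matrix (Fin n) (Fin n) ℂ := fun x => Matrix.of fun k i => inner ℂ (b k) (x i)
  have hM : ∀ x y : Fin n → W, (M x)ᴴ * M y = Matrix.of fun i j => inner ℂ (x i) (y j) := by
    intro x y
    ext i j
    rw [Matrix.mul_apply, Matrix.of_apply, ← b.sum_inner_mul_inner]
    refine Finset.sum_congr rfl fun k _ => ?_
    rw [Matrix.conjTranspose_apply, ← inner_conj_symm (x i)]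
    rfl
  have h1 : (M r)ᴴ * M q = 1 := by
    rw [hM]
    ext i j
    rw [Matrix.of_apply, h, Matrix.one_apply]
  have h2 : (M q)ᴴ * M r = 1 := by
    have := congrArg Matrix.conjTranspose h1
    rwa [Matrix.conjTranspose_mul, Matrix.conjTranspose_conjTranspose,
      Matrix.conjTranspose_one] at this
  have h3 : ∀ x, Matrix.gram ℂ x = (M x)ᴴ * M x := fun x => (hM x x).symm
  rw [h3, h3, Matrix.mul_assoc, ← Matrix.mul_assoc (M q), mul_eq_one_comm.1 h1, Matrix.one_mul, h2]

namespace LagrangianGrassmannian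

variable {n : ℕ} {V : Type*} [NormedAddCommGroup V] [InnerProductSpace ℂ V]
  [FiniteDimensional ℂ V] {σ : SymplecticForm n V}

variable (σ) in
/-- The Riesz representative of `σ(v, ·)`. -/
noncomputable def rieszDual (v : V) : V :=
  haveI := FiniteDimensional.complete ℂ V
  (InnerProductSpace.toDual ℂ V).symm (LinearMap.toContinuousLinearMap (σ.form v))

theorem inner_rieszDual (v w : V) : inner ℂ (rieszDual σ v) w = σ.form v w := by
  have := FiniteDimensional.complete ℂ V
  exact InnerProductSpace.toDual_symm_apply

theorem rieszDual_add (v w : V) : rieszDual σ (v + w) = rieszDual σ v + rieszDual σ w := by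
  refine ext_inner_right ℂ fun x => ?_
  simp only [inner_add_left, inner_rieszDual, map_add, LinearMap.add_apply]

theorem rieszDual_sum_smul {ι : Type*} (s : Finset ι) (c : ι → ℂ) (v : ι → V) :
    rieszDual σ (∑ i ∈ s, c i • v i) = ∑ i ∈ s, starRingEnd ℂ (c i) • rieszDual σ (v i) := by
  refine ext_inner_right ℂ fun x => ?_
  simp only [sum_inner, inner_smul_left, inner_rieszDual, map_sum, map_smul, LinearMap.sum_apply,
    LinearMap.smul_apply, smul_eq_mul, Complex.conj_conj]

/-- Isotropy enters the metric computation here: it supplies vectors of the orthogonal complement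
without computing a projection. -/
theorem rieszDual_mem_orthogonal {L : LagrangianGrassmannian σ} {v : V} (hv : v ∈ L.carrier) :
    rieszDual σ v ∈ L.carrierᗮ := by
  rw [Submodule.mem_orthogonal']
  intro w hw
  rw [inner_rieszDual, L.isotropic v hv w hw]

/-- The Riesz representatives of the first (`Sum.inl`) and last (`Sum.inr`) `n` vectors of a
symplectic frame. -/
noncomputable def dualFrame (g : SymplecticFrame σ) : Fin n ⊕ Fin n → V :=
  Sum.elim (fun i => rieszDual σ (g.toEquiv (Pi.single i 1, 0)))
    fun i => rieszDual σ (g.toEquiv (0, Pi.single i 1))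

/-- Pairing a relation with a vector from the opposite half of the symplectic frame isolates one
coefficient, up to conjugation and sign. -/
theorem linearIndependent_dualFrame (g : SymplecticFrame σ) :
    LinearIndependent ℂ (dualFrame g) := by
  rw [Fintype.linearIndependent_iff]
  intro c hc
  have h1 : ∀ w, inner ℂ (∑ t, c t • dualFrame g t) w = 0 := fun w => by rw [hc, inner_zero_left]
  rintro (j | j)
  · have := h1 (g.toEquiv (0, Pi.single j 1))
    simpa [sum_inner, inner_smul_left, dualFrame, inner_rieszDual, g.map_form, Pi.single_apply]
      using this
  · have := h1 (g.toEquiv (Pi.single j 1, 0))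
    simpa [sum_inner, inner_smul_left, dualFrame, inner_rieszDual, g.map_form, Pi.single_apply]
      using this

/-- The transposed Gram matrix of `dualFrame g`. -/
noncomputable def frameGram (g : SymplecticFrame σ) : Matrix (Fin n ⊕ Fin n) (Fin n ⊕ Fin n) ℂ :=
  (Matrix.gram ℂ (dualFrame g))ᵀ

theorem frameGram_apply (g : SymplecticFrame σ) (i j : Fin n ⊕ Fin n) :
    frameGram g i j = inner ℂ (dualFrame g j) (dualFrame g i) := rfl

open scoped ComplexOrder in
theorem posDef_frameGram (g : SymplecticFrame σ) : (frameGram g).PosDef :=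
  (Matrix.posDef_gram_of_linearIndependent (linearIndependent_dualFrame g)).transpose

theorem frameGram_eq_fromBlocks (g : SymplecticFrame σ) :
    frameGram g = Matrix.fromBlocks (frameGram g).toBlocks₁₁ (frameGram g).toBlocks₁₂
      (frameGram g).toBlocks₁₂ᴴ (frameGram g).toBlocks₂₂ := by
  nth_rewrite 1 [← Matrix.fromBlocks_toBlocks (frameGram g)]
  congr 1
  ext i j
  exact (inner_conj_symm _ _).symm

open scoped ComplexOrder in
theorem posDef_toBlocks₁₁_frameGram (g : SymplecticFrame σ) :
    (frameGram g).toBlocks₁₁.PosDef :=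
  (posDef_frameGram g).submatrix Sum.inl_injective

/-- The Schur complement of the upper left block of `frameGram g`. -/
noncomputable def schurGram (g : SymplecticFrame σ) : Matrix (Fin n) (Fin n) ℂ :=
  (frameGram g).toBlocks₂₂ - (frameGram g).toBlocks₁₂ᴴ * (frameGram g).toBlocks₁₁⁻¹ *
    (frameGram g).toBlocks₁₂

-- The Schur criterion gives semidefiniteness, and `det (frameGram g) = det a · det (schurGram g)`
-- excludes a kernel.
open scoped ComplexOrder in
theorem posDef_schurGram (g : SymplecticFrame σ) : (schurGram g).PosDef := by
  have h1 := posDef_frameGram g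
  have ha := posDef_toBlocks₁₁_frameGram g
  rw [frameGram_eq_fromBlocks] at h1
  let := ha.isUnit.invertible
  have h2 : (schurGram g).PosSemidef := (Matrix.PosDef.fromBlocks₁₁ _ _ ha).1 h1.posSemidef
  rw [h2.posDef_iff_det_ne_zero]
  have h3 := h1.det_pos.ne'
  rw [Matrix.det_fromBlocks₁₁, Matrix.invOf_eq_nonsing_inv] at h3
  exact right_ne_zero_of_mul h3

/-- The transposed Gram matrix of the Riesz representatives of the vectors `g (eᵢ, S eᵢ)`. -/
noncomputable def dualGram (g : SymplecticFrame σ) (S : Matrix (Fin n) (Fin n) ℂ) :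
    Matrix (Fin n) (Fin n) ℂ :=
  graphGram (frameGram g).toBlocks₁₁ (frameGram g).toBlocks₁₂ (frameGram g).toBlocks₂₂ S

/-- The vector `g (eᵢ, S eᵢ)` of the Lagrangian subspace `ofGraph g S`. -/
noncomputable def graphVector (g : SymplecticFrame σ) (S : SymMat n) (i : Fin n) : V :=
  g.toEquiv (Pi.single i 1, SymMat.op S (Pi.single i 1))

theorem rieszDual_graphVector_mem (g : SymplecticFrame σ) (S : SymMat n) (i : Fin n) :
    rieszDual σ (graphVector g S i) ∈ (ofGraph g S).carrierᗮ :=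
  rieszDual_mem_orthogonal (mem_ofGraph.2 ⟨_, rfl⟩)

/-- The Riesz map is antilinear, hence the conjugates. The transposition in `frameGram` undoes them,
so that `dualGram` is polynomial in `S` and `Sᴴ` with `S` on the right. -/
theorem rieszDual_graphVector (g : SymplecticFrame σ) (S : SymMat n) (i : Fin n) :
    rieszDual σ (graphVector g S i) = dualFrame g (Sum.inl i) +
      ∑ k, starRingEnd ℂ (S.1 k i) • dualFrame g (Sum.inr k) := by
  have h1 : graphVector g S i = g.toEquiv (Pi.single i 1, 0) +
      ∑ k, S.1 k i • g.toEquiv (0, Pi.single k 1) := by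
    simp only [← map_smul, ← map_sum, ← map_add, graphVector]
    congr 1
    ext k
    · simp [Prod.fst_sum]
    · simp [Prod.snd_sum, SymMat.op_single, Finset.sum_apply, Pi.single_apply]
  rw [h1, rieszDual_add, rieszDual_sum_smul]
  rfl

theorem dualGram_apply (g : SymplecticFrame σ) (S : SymMat n) (i j : Fin n) :
    dualGram g (Matrix.of S.1) i j =
      inner ℂ (rieszDual σ (graphVector g S j)) (rieszDual σ (graphVector g S i)) := by
  have hb : ∀ k l, star (frameGram g k l) = frameGram g l k := fun k l => inner_conj_symm _ _
  rw [rieszDual_graphVector, rieszDual_graphVector]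
  simp only [inner_add_left, inner_add_right, sum_inner, inner_sum, inner_smul_left,
    inner_smul_right, Complex.conj_conj, ← frameGram_apply]
  simp only [dualGram, graphGram, Matrix.add_apply, Matrix.mul_apply, hb, Matrix.of_apply,
    Matrix.conjTranspose_apply, Matrix.toBlocks₁₁, Matrix.toBlocks₁₂, Matrix.toBlocks₂₂, mul_add,
    Finset.sum_add_distrib, Finset.mul_sum]
  simp only [add_assoc, starRingEnd_apply, mul_comm, mul_left_comm]

/-- The orthogonal projections to the complement of `ofGraph g S` of the last `n` vectors of `g`. -/
noncomputable def quotVector (g : SymplecticFrame σ) (S : SymMat n) (j : Fin n) :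
    (ofGraph g S).carrierᗮ :=
  quotProj (ofGraph g S) (quotFrame g (ofGraph g S) (Pi.single j 1))

/-- The left vector already lies in the complement, so the projection can be dropped; what remains
is a value of `σ` on the symplectic frame. -/
theorem inner_rieszDual_quotVector (g : SymplecticFrame σ) (S : SymMat n) (i j : Fin n) :
    inner ℂ (⟨rieszDual σ (graphVector g S i), rieszDual_graphVector_mem g S i⟩ :
      (ofGraph g S).carrierᗮ) (quotVector g S j) = if i = j then 1 else 0 := by
  have h1 : quotVector g S j =
      (ofGraph g S).carrierᗮ.orthogonalProjectionOnto (g.toEquiv (0, Pi.single j 1)) := rfl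
  rw [h1, Submodule.inner_orthogonalProjectionOnto_eq_of_mem_left, inner_rieszDual, graphVector,
    g.map_form]
  simp [Pi.single_apply, eq_comm]

theorem gram_quotVector_mul_dualGram (g : SymplecticFrame σ) (S : SymMat n) :
    Matrix.gram ℂ (quotVector g S) * (dualGram g (Matrix.of S.1))ᵀ = 1 := by
  have h1 : (dualGram g (Matrix.of S.1))ᵀ = Matrix.gram ℂ fun i =>
      (⟨rieszDual σ (graphVector g S i), rieszDual_graphVector_mem g S i⟩ :
        (ofGraph g S).carrierᗮ) := by
    ext i j
    rw [Matrix.transpose_apply, dualGram_apply]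
    rfl
  rw [h1]
  exact gram_mul_gram_eq_one (orthoBasis _) (inner_rieszDual_quotVector g S)

theorem dualGram_det_ne_zero (g : SymplecticFrame σ) (S : SymMat n) :
    (dualGram g (Matrix.of S.1)).det ≠ 0 := by
  have := congrArg Matrix.det (gram_quotVector_mul_dualGram g S)
  rw [Matrix.det_mul, Matrix.det_transpose, Matrix.det_one] at this
  exact right_ne_zero_of_mul (this ▸ one_ne_zero)

theorem gram_quotVector (g : SymplecticFrame σ) (S : SymMat n) :
    (Matrix.gram ℂ (quotVector g S))ᵀ = (dualGram g (Matrix.of S.1))⁻¹ := by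
  refine (Matrix.inv_eq_right_inv ?_).symm
  have := congrArg Matrix.transpose (gram_quotVector_mul_dualGram g S)
  rwa [Matrix.transpose_mul, Matrix.transpose_transpose, Matrix.transpose_one] at this

theorem quotProj_quotFrame (g : SymplecticFrame σ) (S : SymMat n) (y : Fin n → ℂ) :
    quotProj (ofGraph g S) (quotFrame g (ofGraph g S) y) = ∑ j, y j • quotVector g S j := by
  conv_lhs => rw [pi_eq_sum_univ' y]
  simp only [map_sum, map_smul, quotVector]

theorem det_gram_quotVector (g : SymplecticFrame σ) (S : SymMat n) :
    (Matrix.gram ℂ (quotVector g S)).det = (dualGram g (Matrix.of S.1)).det⁻¹ := by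
  rw [← Matrix.det_transpose, gram_quotVector, Matrix.det_nonsing_inv, Ring.inverse_eq_inv']

theorem twistedMetric_twistedFrame_apply (g : SymplecticFrame σ) (S : SymMat n)
    (x y : Fin n → ℂ) :
    twistedMetric (ofGraph g S) (twistedFrame g (ofGraph g S) x) (twistedFrame g (ofGraph g S) y) =
      inner ℂ (∑ j, x j • quotVector g S j) (∑ j, y j • quotVector g S j) *
        (Matrix.gram ℂ (quotVector g S)).det := by
  rw [twistedFrame_apply, twistedFrame_apply, twistedMetric_tmul_ιMulti, ← quotProj_quotFrame,
    ← quotProj_quotFrame]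
  rfl

/-- The metric of `Q(1)` in the frame given by a symplectic frame. -/
theorem twistedMetric_twistedFrame (g : SymplecticFrame σ) (S : SymMat n) {r : ℕ}
    (A : Matrix (Fin r) (Fin n) ℂ) :
    (Matrix.of fun l m => twistedMetric (ofGraph g S) (twistedFrame g (ofGraph g S) (A m))
        (twistedFrame g (ofGraph g S) (A l))) =
      (dualGram g (Matrix.of S.1)).det⁻¹ • (A * (dualGram g (Matrix.of S.1))⁻¹ * Aᴴ) := by
  ext l m
  rw [Matrix.of_apply, twistedMetric_twistedFrame_apply, Matrix.smul_apply, smul_eq_mul, mul_comm,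
    det_gram_quotVector, ← gram_quotVector]
  congr 1
  simp only [sum_inner, inner_sum, inner_smul_left, inner_smul_right, Matrix.mul_apply,
    Finset.sum_mul, Matrix.conjTranspose_apply, Matrix.transpose_apply, Matrix.gram_apply]
  simp only [Finset.mul_sum]
  rw [Finset.sum_comm]
  refine Finset.sum_congr rfl fun i _ => Finset.sum_congr rfl fun j _ => ?_
  simp only [starRingEnd_apply]
  ring

/-- This carries the definiteness of the metric. In the frame of `g` the squared norm is that of `∑
yⱼ qⱼ` in the orthogonal complement times a nonzero Gram determinant, and the `qⱼ` are independent
because they have a dual family. -/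
theorem twistedProj_injective (L : LagrangianGrassmannian σ) :
    Function.Injective (twistedProj L) := by
  obtain ⟨g, S, rfl⟩ : ∃ g S, ofGraph g S = L := ⟨frameAt L, 0, ofGraph_frameAt L⟩
  rw [← LinearMap.ker_eq_bot, LinearMap.ker_eq_bot']
  intro v hv
  obtain ⟨y, rfl⟩ := (twistedEquiv g (ofGraph g S) (Set.mem_range_self S)).surjective v
  rw [twistedEquiv_apply] at hv
  have h1 : twistedMetric (ofGraph g S) (twistedFrame g (ofGraph g S) y)
      (twistedFrame g (ofGraph g S) y) = 0 := by
    change inner ℂ (twistedProj (ofGraph g S) _) (twistedProj (ofGraph g S) _) = _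
    rw [hv, inner_zero_left]
  rw [twistedMetric_twistedFrame_apply, det_gram_quotVector, mul_eq_zero,
    or_iff_left (inv_ne_zero (dualGram_det_ne_zero g S)), inner_self_eq_zero] at h1
  have h2 : y = 0 := by
    ext i
    have h3 := inner_zero_right (𝕜 := ℂ) (⟨rieszDual σ (graphVector g S i),
      rieszDual_graphVector_mem g S i⟩ : (ofGraph g S).carrierᗮ)
    rw [← h1, inner_sum] at h3
    simp only [inner_smul_right, inner_rieszDual_quotVector] at h3
    simpa using h3
  rw [h2, map_zero]

end LagrangianGrassmannian

/-! ### Arbitrary holomorphic charts and frames, and the conclusion. -/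

namespace LagrangianGrassmannian

variable {n : ℕ} {V : Type*} [NormedAddCommGroup V] [InnerProductSpace ℂ V]
  [FiniteDimensional ℂ V] {σ : SymplecticForm n V}

/-- The matrix of the point of `ofGraph (frameAt L)` with coordinates `z` in the chart `φ`. -/
noncomputable def transitionMatrix (L : LagrangianGrassmannian σ)
    (φ : OpenPartialHomeomorph (LagrangianGrassmannian σ) (SymMat n)) (z : SymMat n) :
    Matrix (Fin n) (Fin n) ℂ :=
  Matrix.of (chartAt (SymMat n) L (φ.symm z)).1

/-- The coordinates of the sections `e` of `Q(1)` in the frame given by `frameAt L`. -/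
noncomputable def sectionMatrix (L : LagrangianGrassmannian σ)
    (φ : OpenPartialHomeomorph (LagrangianGrassmannian σ) (SymMat n)) {r : ℕ}
    (e : Fin r → (M : LagrangianGrassmannian σ) → TwistedQuot M) (z : SymMat n) :
    Matrix (Fin r) (Fin n) ℂ :=
  Matrix.of fun l => (trivializationAt (Fin n → ℂ) (TwistedQuot : LagrangianGrassmannian σ → Type _)
    L ⟨φ.symm z, e l (φ.symm z)⟩).2

variable {L : LagrangianGrassmannian σ}
  {φ : OpenPartialHomeomorph (LagrangianGrassmannian σ) (SymMat n)} {r : ℕ}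
  {e : Fin r → (M : LagrangianGrassmannian σ) → TwistedQuot M} {U : Set (LagrangianGrassmannian σ)}
  {z : SymMat n}

theorem twistedFrame_sectionMatrix (hz : φ.symm z ∈ (chartAt (SymMat n) L).source) (l : Fin r) :
    twistedFrame (frameAt L) (φ.symm z) (sectionMatrix L φ e z l) = e l (φ.symm z) := by
  have h1 : sectionMatrix L φ e z l =
      (twistedEquiv (frameAt L) (φ.symm z) hz).symm (e l (φ.symm z)) := twistedPretriv_apply hz _
  rw [h1, ← twistedEquiv_apply hz, LinearEquiv.apply_symm_apply]

/-- Everything that depends on the chart `φ` and the sections `e` is absorbed into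
`transitionMatrix` and `sectionMatrix`; they are holomorphic when `φ` is in the maximal atlas and
`e` is a holomorphic frame. -/
theorem gramMatrix_twistedMetric (hz : φ.symm z ∈ (chartAt (SymMat n) L).source) :
    gramMatrix (fun L => twistedMetric L) φ e z =
      (dualGram (frameAt L) (transitionMatrix L φ z)).det⁻¹ •
        (sectionMatrix L φ e z * (dualGram (frameAt L) (transitionMatrix L φ z))⁻¹ *
          (sectionMatrix L φ e z)ᴴ) := by
  have h1 : ofGraph (frameAt L) (chartAt (SymMat n) L (φ.symm z)) = φ.symm z :=
    (graphChart (frameAt L)).left_inv hz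
  have h2 := twistedMetric_twistedFrame (frameAt L) (chartAt (SymMat n) L (φ.symm z))
    (sectionMatrix L φ e z)
  rw [h1] at h2
  simp only [twistedFrame_sectionMatrix hz] at h2
  exact h2

theorem contDiffAt_transition (hφ : φ ∈ IsManifold.maximalAtlas 𝓘(ℂ, SymMat n) ω
    (LagrangianGrassmannian σ)) (hzt : z ∈ φ.target)
    (hz : φ.symm z ∈ (chartAt (SymMat n) L).source) :
    ContDiffAt ℂ ω (fun y => chartAt (SymMat n) L (φ.symm y)) z :=
  contMDiffAt_iff_contDiffAt.1 ((contMDiffAt_of_mem_maximalAtlas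
    (IsManifold.chart_mem_maximalAtlas L) hz).comp z (contMDiffAt_symm_of_mem_maximalAtlas hφ hzt))

/-- The entry `S i j` as a continuous linear form. -/
noncomputable def entryCLM (i j : Fin n) : SymMat n →L[ℂ] ℂ :=
  (ContinuousLinearMap.proj j).comp
    ((ContinuousLinearMap.proj (R := ℂ) (φ := fun _ : Fin n => Fin n → ℂ) i).comp
      (SymMat n).subtypeL)

theorem entriesContDiffAt_transitionMatrix (hφ : φ ∈ IsManifold.maximalAtlas 𝓘(ℂ, SymMat n) ω
    (LagrangianGrassmannian σ)) (hzt : z ∈ φ.target)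
    (hz : φ.symm z ∈ (chartAt (SymMat n) L).source) :
    EntriesContDiffAt ℂ ω (transitionMatrix L φ) z := fun i j =>
  (entryCLM i j).contDiff.contDiffAt.comp z (contDiffAt_transition hφ hzt hz)

theorem entryDeriv_transitionMatrix (hφ : φ ∈ IsManifold.maximalAtlas 𝓘(ℂ, SymMat n) ω
    (LagrangianGrassmannian σ)) (hzt : z ∈ φ.target)
    (hz : φ.symm z ∈ (chartAt (SymMat n) L).source) (v : SymMat n) :
    entryDeriv (transitionMatrix L φ) v z =
      Matrix.of (fderiv ℂ (fun y => chartAt (SymMat n) L (φ.symm y)) z v).1 := by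
  ext i j
  have h1 := (contDiffAt_transition (L := L) hφ hzt hz).differentiableAt (by simp)
  exact congrArg (fun f => f v) ((entryCLM i j).hasFDerivAt.comp z h1.hasFDerivAt).fderiv

/-- The opposite change of charts is a left inverse near `z`, and the chain rule passes this to
derivatives. It keeps the symmetric matrices attached to a coordinate basis linearly independent. -/
theorem fderiv_transition_injective (hφ : φ ∈ IsManifold.maximalAtlas 𝓘(ℂ, SymMat n) ω
    (LagrangianGrassmannian σ)) (hzt : z ∈ φ.target)
    (hz : φ.symm z ∈ (chartAt (SymMat n) L).source) :
    Function.Injective (fderiv ℂ (fun y => chartAt (SymMat n) L (φ.symm y)) z) := by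
  set ψ := chartAt (SymMat n) L
  have h1 := (contDiffAt_transition (L := L) hφ hzt hz).differentiableAt (by simp)
  have h2 : ψ.symm (ψ (φ.symm z)) = φ.symm z := ψ.left_inv hz
  have h3 : DifferentiableAt ℂ (fun y => φ (ψ.symm y)) (ψ (φ.symm z)) := by
    have h4 := contMDiffAt_symm_of_mem_maximalAtlas
      (IsManifold.chart_mem_maximalAtlas (I := 𝓘(ℂ, SymMat n)) (n := ω) L) (ψ.map_source hz)
    have h5 : ContMDiffAt 𝓘(ℂ, SymMat n) 𝓘(ℂ, SymMat n) ω φ (ψ.symm (ψ (φ.symm z))) := by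
      rw [h2]
      exact contMDiffAt_of_mem_maximalAtlas hφ (φ.map_target hzt)
    exact (contMDiffAt_iff_contDiffAt.1 (h5.comp _ h4)).differentiableAt (by simp)
  have h6 : (fun y => φ (ψ.symm (ψ (φ.symm y)))) =ᶠ[nhds z] id := by
    have h7 : ∀ᶠ y in nhds z, φ.symm y ∈ ψ.source :=
      (φ.continuousAt_symm hzt).eventually (ψ.open_source.mem_nhds hz)
    filter_upwards [h7, φ.open_target.mem_nhds hzt] with y hy hy'
    rw [ψ.left_inv hy, φ.right_inv hy']
    rfl
  have h8 := (h3.hasFDerivAt.comp z h1.hasFDerivAt).fderiv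
  have h9 : fderiv ℂ ((fun y => φ (ψ.symm y)) ∘ fun y => ψ (φ.symm y)) z =
      ContinuousLinearMap.id ℂ _ := h6.fderiv_eq.trans fderiv_id
  rw [h9] at h8
  intro v w hvw
  have h10 : ∀ v, v = (fderiv ℂ (fun y => φ (ψ.symm y)) (ψ (φ.symm z)))
      (fderiv ℂ (fun y => ψ (φ.symm y)) z v) := fun v => congrArg (fun f => f v) h8
  rw [h10 v, hvw, ← h10 w]

theorem entriesContDiffAt_sectionMatrix (hφ : φ ∈ IsManifold.maximalAtlas 𝓘(ℂ, SymMat n) ω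
    (LagrangianGrassmannian σ)) (hU : IsOpen U)
    (he : IsLocalFrameOn 𝓘(ℂ, SymMat n) (Fin n → ℂ) ω e U) (hzt : z ∈ φ.target)
    (hzU : φ.symm z ∈ U) (hz : φ.symm z ∈ (chartAt (SymMat n) L).source) :
    EntriesContDiffAt ℂ ω (sectionMatrix L φ e) z := by
  intro l i
  have h1 := (Trivialization.contMDiffAt_section_iff (trivializationAt (Fin n → ℂ)
    (TwistedQuot : LagrangianGrassmannian σ → Type _) L) hz).1 (he.contMDiffAt hU hzU l)
  have h2 := contMDiffAt_iff_contDiffAt.1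
    (h1.comp z (contMDiffAt_symm_of_mem_maximalAtlas hφ hzt))
  exact contDiffAt_pi.1 h2 i

theorem linearIndependent_sectionMatrix (he : IsLocalFrameOn 𝓘(ℂ, SymMat n) (Fin n → ℂ) ω e U)
    (hzU : φ.symm z ∈ U) (hz : φ.symm z ∈ (chartAt (SymMat n) L).source) :
    LinearIndependent ℂ (sectionMatrix L φ e z).row := by
  refine LinearIndependent.of_comp (twistedFrame (frameAt L) (φ.symm z)) ?_
  have h1 : twistedFrame (frameAt L) (φ.symm z) ∘ (sectionMatrix L φ e z).row =
      fun l => e l (φ.symm z) := funext fun l => twistedFrame_sectionMatrix hz l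
  rw [h1]
  exact he.linearIndependent hzU

theorem card_eq_of_isLocalFrameOn (he : IsLocalFrameOn 𝓘(ℂ, SymMat n) (Fin n → ℂ) ω e U)
    (hL : L ∈ U) : r = n := by
  rw [← finrank_twistedQuot L, finrank_eq_card_basis (he.toBasisAt hL), Fintype.card_fin]

theorem isHermitianMetric_twistedMetric (σ : SymplecticForm n V) :
    IsHermitianMetric (M := LagrangianGrassmannian σ) (EB := SymMat n) (Fin n → ℂ)
      (fun L => twistedMetric L) where
  conj_symm L v w := inner_conj_symm _ _
  pos L v hv := by
    have h1 : twistedProj L v ≠ 0 := fun h => hv (twistedProj_injective L (h.trans (map_zero _).symm))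
    exact (re_inner_self_pos (𝕜 := ℂ) (x := twistedProj L v)).2 h1
  smooth φ hφ r e U hU he l m := by
    rintro z ⟨hzt, hzU⟩
    apply ContDiffAt.contDiffWithinAt
    -- Smoothness is local, so the affine chart centred at the point itself may be used.
    have hz := mem_chart_source (SymMat n) (φ.symm z)
    have hev : gramMatrix (fun L => twistedMetric L) φ e =ᶠ[nhds z] _ :=
      ((φ.continuousAt_symm hzt).eventually
        ((chartAt (SymMat n) (φ.symm z)).open_source.mem_nhds hz)).mono fun y hy =>
          gramMatrix_twistedMetric hy
    have hK : EntriesContDiffAt ℝ ∞ (fun y => dualGram (frameAt (φ.symm z))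
        (transitionMatrix (φ.symm z) φ y)) z :=
      (entriesContDiffAt_transitionMatrix hφ hzt hz).restrictScalars.graphGram
    have hdet := dualGram_det_ne_zero (frameAt (φ.symm z))
      (chartAt (SymMat n) (φ.symm z) (φ.symm z))
    have hA := (entriesContDiffAt_sectionMatrix hφ hU he hzt hzU hz).restrictScalars
    exact (EntriesContDiffAt.congr (EntriesContDiffAt.smul (hK.det.inv hdet)
      ((hA.mul (hK.inv hdet)).mul hA.conjTranspose)) hev) l m

open scoped ComplexOrder in
theorem isNakanoPositive_twistedMetric (σ : SymplecticForm n V) :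
    IsNakanoPositive (M := LagrangianGrassmannian σ) (EB := SymMat n) (Fin n → ℂ)
      (fun L => twistedMetric L) := by
  intro L φ hφ hL N b r e U hU hLU he
  -- The rank equality makes `sectionMatrix` square, so that it can be inverted.
  obtain rfl := card_eq_of_isLocalFrameOn he hLU
  intro H c
  have hzt := φ.map_source hL
  have hsymm : φ.symm (φ L) = L := φ.left_inv hL
  have hz : φ.symm (φ L) ∈ (chartAt (SymMat r) L).source := by
    rw [hsymm]
    exact mem_chart_source _ L
  have hzU : φ.symm (φ L) ∈ U := by rwa [hsymm]
  have hS := entriesContDiffAt_transitionMatrix hφ hzt hz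
  have hA := entriesContDiffAt_sectionMatrix hφ hU he hzt hzU hz
  -- The symplectic frame at `L` was chosen with `L` as the graph of `0`; the curvature formula
  -- holds at such a zero.
  have hSz : transitionMatrix L φ (φ L) = 0 := by
    have h1 : chartAt (SymMat r) L L = 0 := by
      have := graphChart_ofGraph (frameAt L) 0
      rwa [ofGraph_frameAt] at this
    rw [transitionMatrix, hsymm, h1]
    rfl
  have hAu : IsUnit (sectionMatrix L φ e (φ L)) :=
    Matrix.linearIndependent_rows_iff_isUnit.1 (linearIndependent_sectionMatrix he hzU hz)
  have hev : H =ᶠ[nhds (φ L)] _ :=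
    ((φ.continuousAt_symm hzt).eventually
      ((chartAt (SymMat r) L).open_source.mem_nhds hz)).mono fun y hy =>
        gramMatrix_twistedMetric hy
  have ha := posDef_toBlocks₁₁_frameGram (frameAt L)
  have hD := posDef_schurGram (frameAt L)
  -- The factor `(det a)⁻¹` is a positive real number, so it affects neither symmetry nor
  -- positivity.
  obtain ⟨ρ, hρ, hdet⟩ : ∃ ρ : ℝ, 0 < ρ ∧ (frameGram (frameAt L)).toBlocks₁₁.det⁻¹ = (ρ : ℂ) := by
    have := inv_pos.2 (Complex.pos_iff.1 ha.det_pos).1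
    refine ⟨_, this, ?_⟩
    rw [Complex.ofReal_inv, inv_inj]
    exact Complex.ext rfl (Complex.pos_iff.1 ha.det_pos).2.symm
  have hc : ∀ j k, c j k = (ρ : ℂ) • twistedCurvature (frameGram (frameAt L)).toBlocks₁₁
      (schurGram (frameAt L)) (sectionMatrix L φ e (φ L))
      (entryDeriv (transitionMatrix L φ) (b j) (φ L))
      (entryDeriv (transitionMatrix L φ) (b k) (φ L)) := fun j k => by
    rw [← hdet]
    exact chernCurvature_mul_of_graphGram ha.det_pos.ne' hS hA hSz
      ((Matrix.isUnit_iff_isUnit_det _).1 hAu).ne_zero hev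
  refine ⟨fun j k l m => ?_, fun u hu => ?_⟩
  · rw [hc, hc, ← twistedCurvature_conjTranspose ha.isHermitian hD.isHermitian, Matrix.smul_apply,
      Matrix.smul_apply, Matrix.conjTranspose_apply, smul_eq_mul, smul_eq_mul, map_mul,
      Complex.conj_ofReal]
    rfl
  · have hpos := twistedCurvature_pos ha hD (Matrix.vecMul_injective_of_isUnit hAu)
      (s := fun j => entryDeriv (transitionMatrix L φ) (b j) (φ L)) (fun j => ?_) ?_ hu
    · have h1 : ∑ j, ∑ k, ∑ l, ∑ m, c j k l m * u j l * starRingEnd ℂ (u k m) =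
          (ρ : ℂ) * ∑ j, ∑ k, ∑ l, ∑ m, twistedCurvature (frameGram (frameAt L)).toBlocks₁₁
            (schurGram (frameAt L)) (sectionMatrix L φ e (φ L))
            (entryDeriv (transitionMatrix L φ) (b j) (φ L))
            (entryDeriv (transitionMatrix L φ) (b k) (φ L)) l m * u j l *
              starRingEnd ℂ (u k m) := by
        simp only [hc, Finset.mul_sum, Matrix.smul_apply, smul_eq_mul, mul_assoc]
      rw [h1, Complex.re_ofReal_mul]
      exact mul_pos hρ hpos
    -- The derivative of the transition map takes values in `SymMat`, which is the symmetry that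
    -- makes the form definite.
    · rw [entryDeriv_transitionMatrix hφ hzt hz]
      ext i k
      exact (fderiv ℂ (fun y => chartAt (SymMat r) L (φ.symm y)) (φ L) (b j)).2 k i
    · simp only [entryDeriv_transitionMatrix hφ hzt hz]
      exact b.linearIndependent.map' ((Matrix.ofLinearEquiv ℂ).toLinearMap ∘ₗ (SymMat r).subtype ∘ₗ
        (fderiv ℂ (fun y => chartAt (SymMat r) L (φ.symm y)) (φ L)).toLinearMap)
        (LinearMap.ker_eq_bot.2 ((Matrix.ofLinearEquiv ℂ).injective.comp
          (Subtype.val_injective.comp (fderiv_transition_injective hφ hzt hz))))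

end LagrangianGrassmannian

theorem mainTheorem5 {n : ℕ} {V : Type*} [NormedAddCommGroup V] [InnerProductSpace ℂ V]
    [FiniteDimensional ℂ V] (σ : SymplecticForm n V) :
    IsHermitianMetric (M := LagrangianGrassmannian σ) (EB := SymMat n)
      (Fin n → ℂ) (fun L => LagrangianGrassmannian.twistedMetric L) ∧
    IsNakanoPositive (M := LagrangianGrassmannian σ) (EB := SymMat n)
      (Fin n → ℂ) (fun L => LagrangianGrassmannian.twistedMetric L) :=
  ⟨LagrangianGrassmannian.isHermitianMetric_twistedMetric σ,
    LagrangianGrassmannian.isNakanoPositive_twistedMetric σ⟩
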